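/- Let $d,m\ge 1$, let $b:\mathbb R^d\to\mathbb R^d$ be Borel measurable and bounded, $\|b\|_\infty:=\sup_x|b(x)|<\infty$, and let $\sigma:\mathbb R^d\to\mathbb R^d\otimes\mathbb R^m$. Assume that there are constants $\breve\lambda_0,\hat\lambda_0,L_0>0$ such that, for all $x,y,\xi\in\mathbb R^d$, $$\breve\lambda_0|\xi|^2\le\langle(\sigma\sigma^*)(x)\xi,\xi\rangle\le\hat\lambda_0|\xi|^2,\qquad \|\sigma(x)-\sigma(y)\|_{\mathrm{HS}}\le L_0|x-y|,$$ where $\|\cdot\|_{\mathrm{HS}}$ is the Hilbert–Schmidt norm. Let $W$ be a standard $m$-dimensional Brownian motion, $T>0$ and $\delta\in(0,1)$, and consider the Euler–Maruyama chain $$X^{(\delta)}_{(i+1)\delta}=X^{(\delta)}_{i\delta}+b(X^{(\delta)}_{i\delta})\,\delta+\sigma(X^{(\delta)}_{i\delta})\,(W_{(i+1)\delta}-W_{i\delta}).$$ Then for all integers $0\le j<j'\le\lfloor T/\delta\rfloor$ and every $x\in\mathbb R^d$, the law of $X^{(\delta)}_{j'\delta}$ for the chain started from $X^{(\delta)}_{j\delta}=x$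 has a continuous density $p^{(\delta)}(j\delta,j'\delta,x,\cdot)$ with respect to Lebesgue measure, and for all $x,x'\in\mathbb R^d$ $$p^{(\delta)}(j\delta,j'\delta,x,x')\le \mathrm e^{\frac{\|b\|_\infty T}{2\hat\lambda_0}}\sum_{k=0}^{\infty}\frac{\Big(\sqrt{\pi T}\,\hat C_T\,\big((1+24d)\hat\lambda_0/\breve\lambda_0\big)^d\Big)^k}{\Gamma(1+\frac k2)}\;\cdot\;\frac{\exp\Big(-\frac{|x'-x|^2}{4(1+24d)\hat\lambda_0(j'-j)\delta}\Big)}{\big(2\pi\breve\lambda_0(j'-j)\delta\big)^{d/2}},$$ where $\Gamma$ is the Gamma function and $\hat C_T$, which does not depend on $\delta,j,j',x,x'$, is the maximum $\hat C_T=\max\{A_T,B_T\}$ of $$A_T=2\Big\{\frac{\|b\|_\infty}{\sqrt{\breve\lambda_0}}+2\sqrt d\,L_0\Big(\frac{\hat\lambda_0}{\breve\lambda_0}\Big)^2+d^{\frac d2+1}\,d!\,\Big(\frac{\hat\lambda_0}{\breve\lambda_0}\Big)^dL_0\Big\}\,\mathrm e^{\frac{\|b\|_\infty^2T}{\hat\lambda_0}},$$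 $$\begin{aligned}B_T=\Big\{&2\sqrt{\hat\lambda_0}\,\|b\|_\infty+(\|b\|_\infty^2+2\hat\lambda_0L_0\sqrt d)(\sqrt d+2)\\&+2^{m+11}\breve\lambda_0^{-1}(L_0+2\|b\|_\infty)\Big(\|b\|_\infty^3+(d\hat\lambda_0)^{\frac32}+\breve\lambda_0^{\frac12}(\|b\|_\infty^2+d\hat\lambda_0)\Big)\Big\}\,\frac{2^{\frac{d+1}2}}{\breve\lambda_0}\,\mathrm e^{\frac{(\|b\|_\infty+\|b\|_\infty^2)T}{\hat\lambda_0}}.\end{aligned}$$ -/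

import Mathlib

open MeasureTheory ProbabilityTheory
open scoped NNReal

noncomputable section

namespace EulerMaruyama

/-- `W` is a standard `m`-dimensional Brownian motion under `P`: its coordinates are independent
one-dimensional standard Brownian motions. -/
structure IsBrownianMotion {Ω : Type*} [MeasurableSpace Ω] {m : ℕ}
    (W : ℝ≥0 → Ω → EuclideanSpace ℝ (Fin m)) (P : Measure Ω) : Prop where
  measurable : ∀ t, Measurable (W t)
  coord : ∀ i : Fin m, IsBrownianReal (fun t ω => W t ω i) P
  indep : iIndepFun (fun (i : Fin m) (ω : Ω) (t : ℝ≥0) => W t ω i) P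

/-- The Hilbert-Schmidt norm of a real matrix. -/
def hsNorm {d m : ℕ} (A : Matrix (Fin d) (Fin m) ℝ) : ℝ :=
  Real.sqrt (∑ i, ∑ k, A i k ^ 2)

/-- `‖b‖_∞ = sup_x |b x|`; used only for bounded `b`. -/
def supNorm {d : ℕ} (b : EuclideanSpace ℝ (Fin d) → EuclideanSpace ℝ (Fin d)) : ℝ :=
  ⨆ x, ‖b x‖

/-- Uniform ellipticity of `σ σ*` with constants `lamLo ≤ lamHi`, and Lipschitz continuity of `σ`
in the Hilbert-Schmidt norm with constant `L₀`. -/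
structure EllipticLipschitz {d m : ℕ}
    (σ : EuclideanSpace ℝ (Fin d) → Matrix (Fin d) (Fin m) ℝ) (lamLo lamHi L₀ : ℝ) : Prop where
  lamLo_pos : 0 < lamLo
  lamHi_pos : 0 < lamHi
  L₀_pos : 0 < L₀
  lower : ∀ x ξ : EuclideanSpace ℝ (Fin d),
    lamLo * ‖ξ‖ ^ 2 ≤ inner ℝ (WithLp.toLp 2 ((σ x * (σ x).transpose).mulVec ξ.ofLp)) ξ
  upper : ∀ x ξ : EuclideanSpace ℝ (Fin d),
    inner ℝ (WithLp.toLp 2 ((σ x * (σ x).transpose).mulVec ξ.ofLp)) ξ ≤ lamHi * ‖ξ‖ ^ 2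
  lipschitz : ∀ x y : EuclideanSpace ℝ (Fin d), hsNorm (σ x - σ y) ≤ L₀ * ‖x - y‖

/-- The Euler-Maruyama chain with step `δ` driven by `W`, started from `x` at time `j δ`:
`emChain b σ δ W j x n` is its position at time `(j + n) δ`. -/
def emChain {Ω : Type*} {d m : ℕ}
    (b : EuclideanSpace ℝ (Fin d) → EuclideanSpace ℝ (Fin d))
    (σ : EuclideanSpace ℝ (Fin d) → Matrix (Fin d) (Fin m) ℝ) (δ : ℝ)
    (W : ℝ≥0 → Ω → EuclideanSpace ℝ (Fin m)) (j : ℕ) (x : EuclideanSpace ℝ (Fin d)) :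
    ℕ → Ω → EuclideanSpace ℝ (Fin d)
  | 0, _ => x
  | n + 1, ω =>
      emChain b σ δ W j x n ω + δ • b (emChain b σ δ W j x n ω)
        + WithLp.toLp 2 ((σ (emChain b σ δ W j x n ω)).mulVec
            (W (Real.toNNReal (((j + n + 1 : ℕ) : ℝ) * δ)) ω
              - W (Real.toNNReal (((j + n : ℕ) : ℝ) * δ)) ω).ofLp)

/-- `p x y` is the transition density of the Euler-Maruyama chain from time `j δ` to time `j' δ`
(where `j < j'`): for every starting point `x` at time `j δ`, the law of the chain at time `j' δ`
has density `p x` with respect to Lebesgue measure. Densities being determined only up to null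
sets, the continuous version is taken, which makes the values `p x y` unambiguous. -/
structure IsEMTransitionDensity {Ω : Type*} [MeasurableSpace Ω] {d m : ℕ} (P : Measure Ω)
    (W : ℝ≥0 → Ω → EuclideanSpace ℝ (Fin m))
    (b : EuclideanSpace ℝ (Fin d) → EuclideanSpace ℝ (Fin d))
    (σ : EuclideanSpace ℝ (Fin d) → Matrix (Fin d) (Fin m) ℝ) (δ : ℝ) (j j' : ℕ)
    (p : EuclideanSpace ℝ (Fin d) → EuclideanSpace ℝ (Fin d) → ℝ) : Prop where
  nonneg : ∀ x y, 0 ≤ p x y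
  continuous : ∀ x, Continuous (p x)
  law : ∀ x, P.map (emChain b σ δ W j x (j' - j))
    = volume.withDensity (fun y => ENNReal.ofReal (p x y))

/-- The constant `Ĉ_T`, where `B` stands for `‖b‖_∞`. -/
def cHat (d m : ℕ) (B lamLo lamHi L₀ T : ℝ) : ℝ :=
  max
    (2 * (B / Real.sqrt lamLo
          + 2 * Real.sqrt d * L₀ * (lamHi / lamLo) ^ 2
          + (d : ℝ) ^ ((d : ℝ) / 2 + 1) * (d.factorial : ℝ) * (lamHi / lamLo) ^ d * L₀)
      * Real.exp (B ^ 2 * T / lamHi))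
    ((2 * Real.sqrt lamHi * B
        + (B ^ 2 + 2 * lamHi * L₀ * Real.sqrt d) * (Real.sqrt d + 2)
        + 2 ^ (m + 11) * lamLo⁻¹ * (L₀ + 2 * B)
          * ((B ^ 3 + (d * lamHi) ^ ((3 : ℝ) / 2))
              + Real.sqrt lamLo * (B ^ 2 + d * lamHi)))
      * ((2 : ℝ) ^ (((d : ℝ) + 1) / 2) / lamLo)
      * Real.exp ((B + B ^ 2) * T / lamHi))

/-- The constant in front of the Gaussian bound, where `B` stands for `‖b‖_∞`. -/
def gaussConst (d m : ℕ) (B lamLo lamHi L₀ T : ℝ) : ℝ :=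
  Real.exp (B * T / (2 * lamHi))
    * ∑' k : ℕ,
        (Real.sqrt (Real.pi * T) * cHat d m B lamLo lamHi L₀ T
            * ((1 + 24 * d) * lamHi / lamLo) ^ d) ^ k
          / Real.Gamma (1 + (k : ℝ) / 2)

end EulerMaruyama

end

open EulerMaruyama

/-! The proof is a parametrix expansion with coefficients frozen at the terminal point. Fix the
target y and compare the chain with the driftless Gaussian walk whose covariance per unit time is
constantly a(y), where a = σσ*. Running the true chain for i steps and the frozen walk for the
remaining ones interpolates between the frozen Gaussian density and the true density. Two
consecutive interpolants differ in a single step, by the Chapman-Kolmogorov identity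
`integral_succ`; this is the telescoping sum `stepDensity_eq_sum`.

In one such difference the covariance changes by δ(a(z) - a(y)), of order δ|y - z|, and the mean by
δb(z), while the total covariance is of order t, the time left including that step. Powers of |y -
z|/√t are absorbed by widening the Gaussian, so the difference is at most a constant times δ/√t
times a Gaussian of covariance 4 λ̂₀ t (`abs_kernel_le`).

The widening does not accumulate. All majorants are multiples, by Q = (4 λ̂₀/λ̆₀)^(d/2), of
isotropic densities, which are closed under convolution. If the law at each step i ≤ n is dominated
by the isotropic Gaussian of time iδ, every term of the expansion carries the same Gaussian of time
(n+1)δ, and only a scalar Volterra inequality with kernel δ/√((n+1-i)δ) is left. The Mittag-Leffler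
series of order 1/2 is a supersolution (`one_add_sum_mittagLeffler_le`): left Riemann sums of the
increasing Beta integrand lie below the Beta integral, which carries the k-th term of the series to
the (k+1)-th. Strong induction on the number of steps then gives `stepDensity_le`.

Probability enters only in `isGaussianChain_emChain`, which says that the laws of the scheme evolve
through Gaussian transitions. The constants of the statement are weaker than those obtained: the
Gaussian is wider, and `kernelConst_mul_le` needs only the first member A_T of the maximum Ĉ_T. -/

namespace EulerMaruyama

variable {d m n : ℕ}

local notation "𝔼" => EuclideanSpace ℝ

/-! ### Quadratic forms, ellipticity and inversion. -/

section

/-- The linear map between Euclidean spaces with the given matrix. -/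
noncomputable abbrev act (M : Matrix (Fin d) (Fin m) ℝ) : 𝔼 (Fin m) →ₗ[ℝ] 𝔼 (Fin d) :=
  Matrix.toEuclideanLin M

lemma act_mul (A : Matrix (Fin d) (Fin m) ℝ) (B : Matrix (Fin m) (Fin n) ℝ) (w : 𝔼 (Fin n)) :
    act (A * B) w = act A (act B w) := by
  simp only [act, Matrix.toEuclideanLin, Matrix.toLpLin_mul_same, LinearMap.comp_apply]

lemma act_one (w : 𝔼 (Fin d)) : act (1 : Matrix (Fin d) (Fin d) ℝ) w = w := by
  simp [act, Matrix.toEuclideanLin]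

lemma inner_act_left (A : Matrix (Fin d) (Fin m) ℝ) (v : 𝔼 (Fin m)) (w : 𝔼 (Fin d)) :
    inner ℝ (act A v) w = inner ℝ v (act A.transpose w) := by
  have h := Matrix.toEuclideanLin_conjTranspose_eq_adjoint A
  rw [Matrix.conjTranspose_eq_transpose_of_trivial] at h
  rw [act, act, h, LinearMap.adjoint_inner_right]

/-- The quadratic form of a matrix. -/
noncomputable def qf (M : Matrix (Fin d) (Fin d) ℝ) (w : 𝔼 (Fin d)) : ℝ := inner ℝ (act M w) w

lemma qf_add (A B : Matrix (Fin d) (Fin d) ℝ) (w : 𝔼 (Fin d)) :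
    qf (A + B) w = qf A w + qf B w := by
  simp [qf, inner_add_left]

lemma qf_smul (c : ℝ) (A : Matrix (Fin d) (Fin d) ℝ) (w : 𝔼 (Fin d)) :
    qf (c • A) w = c * qf A w := by
  simp [qf, inner_smul_left]

lemma qf_one (w : 𝔼 (Fin d)) : qf (1 : Matrix (Fin d) (Fin d) ℝ) w = ‖w‖ ^ 2 := by
  simp [qf]

lemma qf_smul_right (c : ℝ) (A : Matrix (Fin d) (Fin d) ℝ) (w : 𝔼 (Fin d)) :
    qf A (c • w) = c ^ 2 * qf A w := by
  simp [qf, inner_smul_left, inner_smul_right]; ring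

lemma qf_mul_transpose (A : Matrix (Fin d) (Fin m) ℝ) (w : 𝔼 (Fin d)) :
    qf (A * A.transpose) w = ‖act A.transpose w‖ ^ 2 := by
  rw [qf, act_mul, inner_act_left, real_inner_self_eq_norm_sq]

lemma qf_transpose_mul (A : Matrix (Fin m) (Fin d) ℝ) (w : 𝔼 (Fin d)) :
    qf (A.transpose * A) w = ‖act A w‖ ^ 2 := by
  rw [qf, act_mul, inner_act_left, Matrix.transpose_transpose, real_inner_self_eq_norm_sq]

lemma continuous_act (M : Matrix (Fin d) (Fin m) ℝ) : Continuous (act M) :=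
  LinearMap.continuous_of_finiteDimensional _

lemma continuous_qf (M : Matrix (Fin d) (Fin d) ℝ) : Continuous (qf M) :=
  (continuous_act M).inner continuous_id

/-- `M` is symmetric with spectrum in `[α, β]`, where `α > 0`. -/
structure IsElliptic (M : Matrix (Fin d) (Fin d) ℝ) (α β : ℝ) : Prop where
  pos : 0 < α
  pos' : 0 < β
  symm : M.transpose = M
  lower : ∀ w, α * ‖w‖ ^ 2 ≤ qf M w
  upper : ∀ w, qf M w ≤ β * ‖w‖ ^ 2

namespace IsElliptic

variable {M M₁ M₂ : Matrix (Fin d) (Fin d) ℝ} {α β α₁ β₁ α₂ β₂ : ℝ}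

lemma scalar {s : ℝ} (hs : 0 < s) : IsElliptic (s • (1 : Matrix (Fin d) (Fin d) ℝ)) s s where
  pos := hs
  pos' := hs
  symm := by simp
  lower w := by rw [qf_smul, qf_one]
  upper w := by rw [qf_smul, qf_one]

lemma add (h₁ : IsElliptic M₁ α₁ β₁) (h₂ : IsElliptic M₂ α₂ β₂) :
    IsElliptic (M₁ + M₂) (α₁ + α₂) (β₁ + β₂) where
  pos := add_pos h₁.pos h₂.pos
  pos' := add_pos h₁.pos' h₂.pos'
  symm := by rw [Matrix.transpose_add, h₁.symm, h₂.symm]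
  lower w := by rw [qf_add, add_mul]; exact add_le_add (h₁.lower w) (h₂.lower w)
  upper w := by rw [qf_add, add_mul]; exact add_le_add (h₁.upper w) (h₂.upper w)

lemma smul {c : ℝ} (hc : 0 < c) (h : IsElliptic M α β) : IsElliptic (c • M) (c * α) (c * β) where
  pos := mul_pos hc h.pos
  pos' := mul_pos hc h.pos'
  symm := by rw [Matrix.transpose_smul, h.symm]
  lower w := by rw [qf_smul, mul_assoc]; exact mul_le_mul_of_nonneg_left (h.lower w) hc.le
  upper w := by rw [qf_smul, mul_assoc]; exact mul_le_mul_of_nonneg_left (h.upper w) hc.le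

lemma qf_nonneg (h : IsElliptic M α β) (w : 𝔼 (Fin d)) : 0 ≤ qf M w :=
  (mul_nonneg h.pos.le (sq_nonneg _)).trans (h.lower w)

lemma posDef (h : IsElliptic M α β) : M.PosDef := by
  refine Matrix.PosDef.of_dotProduct_mulVec_pos ?_ fun x hx => ?_
  · rw [Matrix.IsHermitian, Matrix.conjTranspose_eq_transpose_of_trivial, h.symm]
  · have h1 := h.lower (WithLp.toLp 2 x)
    have h2 : 0 < ‖(WithLp.toLp 2 x : 𝔼 (Fin d))‖ := by
      rw [norm_pos_iff]; intro h0; exact hx (by simpa using h0)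
    have h3 : qf M (WithLp.toLp 2 x) = star x ⬝ᵥ (M.mulVec x) := by
      simp [qf, act, EuclideanSpace.inner_eq_star_dotProduct]
    rw [← h3]
    have := h.pos
    exact lt_of_lt_of_le (by positivity) h1

lemma isUnit (h : IsElliptic M α β) : IsUnit M.det :=
  (Matrix.isUnit_iff_isUnit_det M).1 h.posDef.isUnit

lemma act_inv (h : IsElliptic M α β) (w : 𝔼 (Fin d)) : act M (act M⁻¹ w) = w := by
  rw [← act_mul, Matrix.mul_nonsing_inv _ h.isUnit, act_one]

lemma inner_symm (h : IsElliptic M α β) (v w : 𝔼 (Fin d)) :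
    inner ℝ (act M v) w = inner ℝ v (act M w) := by
  rw [inner_act_left, h.symm]

lemma symm_inv (h : IsElliptic M α β) : M⁻¹.transpose = M⁻¹ := by
  rw [Matrix.transpose_nonsing_inv, h.symm]

/-- The variational characterisation of the inverse form, inequality. -/
lemma two_inner_sub_qf_le (h : IsElliptic M α β) (v w : 𝔼 (Fin d)) :
    2 * inner ℝ w v - qf M v ≤ qf M⁻¹ w := by
  -- Completing the square: the form of `M` at `v - M⁻¹ w` is nonnegative.
  have h1 := h.qf_nonneg (v - act M⁻¹ w)
  have h2 : qf M (v - act M⁻¹ w) = qf M v - 2 * inner ℝ w v + qf M⁻¹ w := by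
    have e : inner ℝ (act M v) (act M⁻¹ w) = inner ℝ w v := by
      rw [h.inner_symm, h.act_inv, real_inner_comm]
    rw [qf, map_sub, h.act_inv, inner_sub_left, inner_sub_right, inner_sub_right, e, qf, qf,
      real_inner_comm w]
    ring
  linarith

lemma qf_inv_eq (h : IsElliptic M α β) (w : 𝔼 (Fin d)) :
    qf M⁻¹ w = 2 * inner ℝ w (act M⁻¹ w) - qf M (act M⁻¹ w) := by
  rw [qf, qf, h.act_inv, real_inner_comm w]; ring

/-- Inversion reverses the order of forms. The variational expression for `M₂⁻¹` is attained at `v =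
M₂⁻¹ w`; testing the one for `M₁⁻¹` with `c⁻¹ • v` compares the two without simultaneous
diagonalisation. -/
lemma qf_inv_le_of_le (h₁ : IsElliptic M₁ α₁ β₁) (h₂ : IsElliptic M₂ α₂ β₂) {c : ℝ} (hc : 0 < c)
    (h : ∀ w, qf M₁ w ≤ c * qf M₂ w) (w : 𝔼 (Fin d)) : qf M₂⁻¹ w ≤ c * qf M₁⁻¹ w := by
  rw [h₂.qf_inv_eq]
  set v := act M₂⁻¹ w
  have h3 := h₁.two_inner_sub_qf_le (c⁻¹ • v) w
  rw [inner_smul_right, qf_smul_right] at h3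
  have h4 := h v
  have h5 : c * (2 * (c⁻¹ * inner ℝ w v) - c⁻¹ ^ 2 * qf M₁ v) ≤ c * qf M₁⁻¹ w :=
    mul_le_mul_of_nonneg_left h3 hc.le
  have h6 : c * (2 * (c⁻¹ * inner ℝ w v) - c⁻¹ ^ 2 * qf M₁ v)
      = 2 * inner ℝ w v - c⁻¹ * qf M₁ v := by field_simp
  have h7 : c⁻¹ * qf M₁ v ≤ qf M₂ v := by rw [inv_mul_le_iff₀ hc]; exact h4
  linarith

lemma inv (h : IsElliptic M α β) : IsElliptic M⁻¹ β⁻¹ α⁻¹ where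
  pos := inv_pos.2 h.pos'
  pos' := inv_pos.2 h.pos
  symm := h.symm_inv
  lower w := by
    have h1 := h.qf_inv_le_of_le (scalar (d := d) one_pos) h.pos'
      (fun w => by simpa [qf_one] using h.upper w) w
    rw [one_smul, inv_one, qf_one] at h1
    rwa [inv_mul_le_iff₀ h.pos']
  upper w := by
    have h1 := (scalar (d := d) one_pos).qf_inv_le_of_le h (inv_pos.2 h.pos)
      (fun w => by rw [one_smul, qf_one, ← div_eq_inv_mul, le_div_iff₀ h.pos, mul_comm]; exact h.lower w) w
    rwa [one_smul, inv_one, qf_one] at h1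

lemma norm_act_inv_le (h : IsElliptic M α β) (w : 𝔼 (Fin d)) : ‖act M⁻¹ w‖ ≤ ‖w‖ / α := by
  have h1 := h.lower (act M⁻¹ w)
  rw [qf, h.act_inv] at h1
  have h2 := real_inner_le_norm w (act M⁻¹ w)
  rw [le_div_iff₀ h.pos]
  rcases (norm_nonneg (act M⁻¹ w)).eq_or_lt with h0 | h0
  · rw [← h0]; simp
  · nlinarith

lemma abs_qf_inv_sub_le (h : IsElliptic M α β) (v w : 𝔼 (Fin d)) :
    |qf M⁻¹ v - qf M⁻¹ w| ≤ ‖v - w‖ * (‖v‖ + ‖w‖) / α := by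
  have e : qf M⁻¹ v - qf M⁻¹ w = inner ℝ (act M⁻¹ (v - w)) (v + w) := by
    have := h.inv.inner_symm w v
    rw [qf, qf, map_sub, inner_sub_left, inner_add_right, inner_add_right, this,
      real_inner_comm (act M⁻¹ v) w]
    ring
  rw [e]
  calc _ ≤ ‖act M⁻¹ (v - w)‖ * ‖v + w‖ := abs_real_inner_le_norm _ _
    _ ≤ ‖v - w‖ / α * (‖v‖ + ‖w‖) := by
      gcongr
      · exact div_nonneg (norm_nonneg _) h.pos.le
      · exact h.norm_act_inv_le _
      · exact norm_add_le _ _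
    _ = _ := by ring

open scoped ComplexOrder MatrixOrder Matrix.Norms.L2Operator in
/-- An elliptic matrix factors as `SᵀS` with `S` invertible. -/
lemma exists_factor (h : IsElliptic M α β) :
    ∃ S : Matrix (Fin d) (Fin d) ℝ, IsUnit S.det ∧ M = S.transpose * S := by
  obtain ⟨S, hS, e⟩ := CStarAlgebra.isStrictlyPositive_iff_eq_star_mul_self.mp
    h.posDef.isStrictlyPositive
  exact ⟨S, (Matrix.isUnit_iff_isUnit_det S).1 hS, by
    rw [e, Matrix.star_eq_conjTranspose, Matrix.conjTranspose_eq_transpose_of_trivial]⟩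

end IsElliptic

end

/-! ### Gaussian densities, their Fourier transforms and convolutions. -/

section

/-- The Gaussian integral of the quadratic form of `M`. -/
noncomputable def gaussMass (M : Matrix (Fin d) (Fin d) ℝ) : ℝ :=
  ∫ ξ : 𝔼 (Fin d), Real.exp (-(qf M ξ / 2))

/-- The centred Gaussian density with covariance `M`. -/
noncomputable def gaussDensity (M : Matrix (Fin d) (Fin d) ℝ) (w : 𝔼 (Fin d)) : ℝ :=
  ((2 * Real.pi) ^ d)⁻¹ * gaussMass M * Real.exp (-(qf M⁻¹ w / 2))

lemma integral_comp_act {F : Type*} [NormedAddCommGroup F] [NormedSpace ℝ F]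
    {S : Matrix (Fin d) (Fin d) ℝ} (hS : IsUnit S.det) {g : 𝔼 (Fin d) → F} (hg : Continuous g) :
    ∫ ξ, g (act S ξ) = |S.det|⁻¹ • ∫ η, g η := by
  have hdet : LinearMap.det (act S) = S.det := by
    simp [act, Matrix.toEuclideanLin]
  have h0 : LinearMap.det (act S) ≠ 0 := by rw [hdet]; exact hS.ne_zero
  have h1 := Measure.map_linearMap_addHaar_eq_smul_addHaar (volume : Measure (𝔼 (Fin d))) h0
  rw [← integral_map (continuous_act S).aemeasurable
    (hg.stronglyMeasurable.aestronglyMeasurable), h1, integral_smul_measure,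
    ENNReal.toReal_ofReal (abs_nonneg _), hdet, abs_inv]

lemma gaussMass_transpose_mul {S : Matrix (Fin d) (Fin d) ℝ} (hS : IsUnit S.det) :
    gaussMass (S.transpose * S) = |S.det|⁻¹ * (2 * Real.pi) ^ ((d : ℝ) / 2) := by
  simp_rw [gaussMass, qf_transpose_mul]
  rw [integral_comp_act hS (g := fun η : 𝔼 (Fin d) => Real.exp (-(‖η‖ ^ 2 / 2)))
    (by fun_prop), smul_eq_mul]
  congr 1
  have := GaussianFourier.integral_rexp_neg_mul_sq_norm (V := 𝔼 (Fin d)) (b := 1 / 2) (by norm_num)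
  rw [finrank_euclideanSpace_fin] at this
  convert this using 3
  · ring_nf
  · ring

lemma integral_fourier_transpose_mul {S : Matrix (Fin d) (Fin d) ℝ} (hS : IsUnit S.det)
    (w : 𝔼 (Fin d)) :
    ∫ ξ : 𝔼 (Fin d), Complex.exp (-(qf (S.transpose * S) ξ / 2 : ℝ) + Complex.I * (inner ℝ w ξ : ℝ))
      = (gaussMass (S.transpose * S) : ℂ)
        * Complex.exp (-(qf (S.transpose * S)⁻¹ w / 2 : ℝ)) := by
  set v := act S⁻¹.transpose w
  have h1 : ∀ ξ : 𝔼 (Fin d), inner ℝ w ξ = inner ℝ v (act S ξ) := fun ξ => by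
    rw [inner_act_left, Matrix.transpose_transpose, ← act_mul, Matrix.nonsing_inv_mul _ hS, act_one]
  have h2 : qf (S.transpose * S)⁻¹ w = ‖v‖ ^ 2 := by
    rw [Matrix.mul_inv_rev, ← Matrix.transpose_nonsing_inv, qf_mul_transpose]
  simp_rw [h1, qf_transpose_mul, h2, gaussMass_transpose_mul hS]
  rw [integral_comp_act hS (g := fun η : 𝔼 (Fin d) =>
    Complex.exp (-(‖η‖ ^ 2 / 2 : ℝ) + Complex.I * (inner ℝ v η : ℝ))) (by fun_prop)]
  have := GaussianFourier.integral_cexp_neg_mul_sq_norm_add (V := 𝔼 (Fin d)) (b := 1 / 2)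
    (by norm_num) Complex.I v
  rw [finrank_euclideanSpace_fin] at this
  have e : ∀ η : 𝔼 (Fin d), Complex.exp (-(‖η‖ ^ 2 / 2 : ℝ) + Complex.I * (inner ℝ v η : ℝ))
      = Complex.exp (-(1 / 2) * (‖η‖ : ℂ) ^ 2 + Complex.I * (inner ℝ v η : ℝ)) := fun η => by
    congr 2; push_cast; ring
  simp_rw [e]
  rw [this, Complex.real_smul]
  push_cast
  rw [Complex.ofReal_cpow (by positivity)]
  push_cast
  rw [mul_assoc]
  congr 3
  · ring
  · rw [Complex.I_sq]; ring

namespace IsElliptic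

variable {M M₁ M₂ : Matrix (Fin d) (Fin d) ℝ} {α β α₁ β₁ α₂ β₂ : ℝ}

lemma integral_fourier (h : IsElliptic M α β) (w : 𝔼 (Fin d)) :
    ∫ ξ : 𝔼 (Fin d), Complex.exp (-(qf M ξ / 2 : ℝ) + Complex.I * (inner ℝ w ξ : ℝ))
      = (gaussMass M : ℂ) * Complex.exp (-(qf M⁻¹ w / 2 : ℝ)) := by
  obtain ⟨S, hS, rfl⟩ := h.exists_factor
  exact integral_fourier_transpose_mul hS w

lemma gaussMass_pos (h : IsElliptic M α β) : 0 < gaussMass M := by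
  obtain ⟨S, hS, rfl⟩ := h.exists_factor
  rw [gaussMass_transpose_mul hS]
  have := abs_pos.2 hS.ne_zero
  positivity

/-- This identity is what makes `gaussDensity` integrate to 1. Normalising by the mass of `M`
instead of a determinant makes the prefactor visibly monotone in the form of `M`. -/
lemma gaussMass_mul_inv (h : IsElliptic M α β) :
    gaussMass M * gaussMass M⁻¹ = (2 * Real.pi) ^ d := by
  obtain ⟨S, hS, rfl⟩ := h.exists_factor
  have e : (S.transpose * S)⁻¹ = (S⁻¹.transpose).transpose * S⁻¹.transpose := by
    rw [Matrix.mul_inv_rev, ← Matrix.transpose_nonsing_inv, Matrix.transpose_transpose]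
  have hS' : IsUnit (S⁻¹.transpose).det := by
    rw [Matrix.det_transpose]; exact Matrix.isUnit_nonsing_inv_det S hS
  rw [e, gaussMass_transpose_mul hS, gaussMass_transpose_mul hS', Matrix.det_transpose,
    Matrix.det_nonsing_inv, Ring.inverse_eq_inv', abs_inv, inv_inv]
  have h1 : |S.det| ≠ 0 := abs_ne_zero.2 hS.ne_zero
  have h2 : (2 * Real.pi) ^ ((d : ℝ) / 2) * (2 * Real.pi) ^ ((d : ℝ) / 2) = (2 * Real.pi) ^ d := by
    rw [← Real.rpow_add (by positivity), add_halves, Real.rpow_natCast]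
  rw [← h2]; field_simp

lemma integrable_exp (h : IsElliptic M α β) :
    Integrable (fun ξ : 𝔼 (Fin d) => Real.exp (-(qf M ξ / 2))) :=
  -- The Bochner integral of a non-integrable function is 0, so a positive mass already gives
  -- integrability.
  Integrable.of_integral_ne_zero h.gaussMass_pos.ne'

lemma gaussDensity_pos (h : IsElliptic M α β) (w : 𝔼 (Fin d)) : 0 < gaussDensity M w := by
  have := h.gaussMass_pos
  unfold gaussDensity
  positivity

lemma continuous_gaussDensity (M : Matrix (Fin d) (Fin d) ℝ) : Continuous (gaussDensity M) := by
  have := continuous_qf M⁻¹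
  unfold gaussDensity
  fun_prop

/-- Fourier inversion for the Gaussian density. -/
lemma gaussDensity_eq (h : IsElliptic M α β) (w : 𝔼 (Fin d)) :
    (gaussDensity M w : ℂ) = (((2 * Real.pi) ^ d)⁻¹ : ℝ) *
      ∫ ξ : 𝔼 (Fin d), Complex.exp (-(qf M ξ / 2 : ℝ) + Complex.I * (inner ℝ w ξ : ℝ)) := by
  rw [h.integral_fourier, gaussDensity]
  push_cast
  ring

lemma integral_gaussDensity_mul (h : IsElliptic M α β) (ξ : 𝔼 (Fin d)) :
    ∫ w : 𝔼 (Fin d), (gaussDensity M w : ℂ) * Complex.exp (Complex.I * (inner ℝ w ξ : ℝ))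
      = Complex.exp (-(qf M ξ / 2 : ℝ)) := by
  have h1 := h.inv.integral_fourier ξ
  rw [Matrix.nonsing_inv_nonsing_inv _ h.isUnit] at h1
  have e : ∀ w : 𝔼 (Fin d), (gaussDensity M w : ℂ) * Complex.exp (Complex.I * (inner ℝ w ξ : ℝ))
      = ((((2 * Real.pi) ^ d)⁻¹ * gaussMass M : ℝ) : ℂ) *
        Complex.exp (-(qf M⁻¹ w / 2 : ℝ) + Complex.I * (inner ℝ ξ w : ℝ)) := fun w => by
    rw [Complex.exp_add, gaussDensity, real_inner_comm]
    push_cast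
    ring
  simp_rw [e]
  rw [integral_const_mul, h1, ← mul_assoc, ← Complex.ofReal_mul, mul_assoc, h.gaussMass_mul_inv,
    inv_mul_cancel₀ (by positivity)]
  simp

lemma integrable_gaussDensity (h : IsElliptic M α β) : Integrable (gaussDensity M) :=
  h.inv.integrable_exp.const_mul _

lemma integral_gaussDensity (h : IsElliptic M α β) : ∫ w, gaussDensity M w = 1 := by
  have h1 := h.integral_gaussDensity_mul 0
  simp only [inner_zero_right, Complex.ofReal_zero, mul_zero, Complex.exp_zero, mul_one] at h1
  rw [integral_complex_ofReal] at h1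
  have : qf M 0 = 0 := by simp [qf]
  rw [this] at h1
  simpa using h1

end IsElliptic

/-- The measure with Gaussian density of covariance `M` and mean `a`. -/
noncomputable def gaussMeasure (a : 𝔼 (Fin d)) (M : Matrix (Fin d) (Fin d) ℝ) :
    Measure (𝔼 (Fin d)) :=
  volume.withDensity fun y => ENNReal.ofReal (gaussDensity M (y - a))

namespace IsElliptic

variable {M M₁ M₂ : Matrix (Fin d) (Fin d) ℝ} {α β α₁ β₁ α₂ β₂ : ℝ}

lemma isProbabilityMeasure_gaussMeasure (h : IsElliptic M α β) (a : 𝔼 (Fin d)) :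
    IsProbabilityMeasure (gaussMeasure a M) := by
  constructor
  rw [gaussMeasure, withDensity_apply _ MeasurableSet.univ, setLIntegral_univ,
    ← ofReal_integral_eq_lintegral_ofReal (h.integrable_gaussDensity.comp_sub_right a)
      (Filter.Eventually.of_forall fun y => (h.gaussDensity_pos _).le),
    integral_sub_right_eq_self (gaussDensity M) a, h.integral_gaussDensity, ENNReal.ofReal_one]

lemma integral_gaussMeasure {F : Type*} [NormedAddCommGroup F] [NormedSpace ℝ F]
    (h : IsElliptic M α β) (a : 𝔼 (Fin d)) (f : 𝔼 (Fin d) → F) :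
    ∫ y, f y ∂(gaussMeasure a M) = ∫ y, gaussDensity M (y - a) • f y := by
  have hc : Continuous fun y => gaussDensity M (y - a) :=
    (continuous_gaussDensity M).comp (by fun_prop)
  rw [gaussMeasure, integral_withDensity_eq_integral_toReal_smul
    (hc.measurable.ennreal_ofReal) (by simp)]
  simp_rw [ENNReal.toReal_ofReal (h.gaussDensity_pos _).le]

lemma charFun_gaussMeasure (h : IsElliptic M α β) (a ξ : 𝔼 (Fin d)) :
    charFun (gaussMeasure a M) ξ
      = Complex.exp (-(qf M ξ / 2 : ℝ) + Complex.I * (inner ℝ a ξ : ℝ)) := by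
  rw [charFun_apply, h.integral_gaussMeasure, Complex.exp_add, ← h.integral_gaussDensity_mul ξ,
    ← integral_mul_const, ← integral_sub_right_eq_self (fun w : 𝔼 (Fin d) =>
      (gaussDensity M w : ℂ) * Complex.exp (Complex.I * (inner ℝ w ξ : ℝ))
        * Complex.exp (Complex.I * (inner ℝ a ξ : ℝ))) a]
  congr 1
  ext y
  rw [Complex.real_smul, mul_assoc, ← Complex.exp_add]
  congr 2
  rw [inner_sub_left]
  push_cast
  ring

/-- Convolution of a Gaussian density with a law having a Gaussian characteristic function. -/
lemma integral_gaussDensity_sub (h : IsElliptic M α β) {N : Matrix (Fin d) (Fin d) ℝ}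
    (hN : IsElliptic (M + N) α₁ β₁) (ν : Measure (𝔼 (Fin d))) [IsProbabilityMeasure ν]
    (a : 𝔼 (Fin d)) (hν : ∀ ξ, charFun ν ξ
      = Complex.exp (-(qf N ξ / 2 : ℝ) + Complex.I * (inner ℝ a ξ : ℝ))) (y : 𝔼 (Fin d)) :
    ∫ z, gaussDensity M (y - z) ∂ν = gaussDensity (M + N) (y - a) := by
  have hq := continuous_qf M
  rw [← Complex.ofReal_inj, ← integral_complex_ofReal]
  simp_rw [h.gaussDensity_eq]
  rw [integral_const_mul, hN.gaussDensity_eq, integral_integral_swap]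
  · congr 2
    ext ξ
    have e : ∀ z : 𝔼 (Fin d),
        Complex.exp (-(qf M ξ / 2 : ℝ) + Complex.I * (inner ℝ (y - z) ξ : ℝ))
        = Complex.exp (-(qf M ξ / 2 : ℝ) + Complex.I * (inner ℝ y ξ : ℝ))
          * Complex.exp ((inner ℝ z (-ξ) : ℝ) * Complex.I) := fun z => by
      rw [← Complex.exp_add, inner_sub_left, inner_neg_right]
      congr 1
      push_cast
      ring
    simp_rw [e]
    rw [integral_const_mul, ← charFun_apply, hν, ← Complex.exp_add]
    have : qf N (-ξ) = qf N ξ := by simp [qf]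
    rw [this, inner_sub_left, inner_neg_right, qf_add]
    congr 1
    push_cast
    ring
  -- Fubini is legitimate because the modulus of the integrand does not depend on `z`.
  · have h1 : Integrable (fun p : 𝔼 (Fin d) × 𝔼 (Fin d) => Real.exp (-(qf M p.2 / 2)))
        (ν.prod volume) := h.integrable_exp.comp_snd ν
    refine h1.mono' ?_ (Filter.Eventually.of_forall fun p => ?_)
    · refine Continuous.aestronglyMeasurable ?_
      simp only [Function.uncurry_def]
      fun_prop
    · simp only [Function.uncurry_def]
      rw [Complex.norm_exp]
      simp

lemma integral_gaussDensity_gaussMeasure (h₁ : IsElliptic M₁ α₁ β₁) (h₂ : IsElliptic M₂ α₂ β₂)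
    (a y : 𝔼 (Fin d)) :
    ∫ z, gaussDensity M₁ (y - z) ∂(gaussMeasure a M₂) = gaussDensity (M₁ + M₂) (y - a) := by
  have := h₂.isProbabilityMeasure_gaussMeasure a
  exact h₁.integral_gaussDensity_sub (h₁.add h₂) _ a (h₂.charFun_gaussMeasure a) y

end IsElliptic

end

/-! ### Comparison of Gaussian densities with different arguments or covariances. -/

section

lemma gaussMass_scalar {s : ℝ} (hs : 0 < s) :
    gaussMass (s • (1 : Matrix (Fin d) (Fin d) ℝ)) = (2 * Real.pi / s) ^ ((d : ℝ) / 2) := by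
  have := GaussianFourier.integral_rexp_neg_mul_sq_norm (V := 𝔼 (Fin d)) (b := s / 2)
    (by positivity)
  rw [finrank_euclideanSpace_fin] at this
  simp_rw [gaussMass, qf_smul, qf_one]
  have e : Real.pi / (s / 2) = 2 * Real.pi / s := by field_simp
  rw [e] at this
  convert this using 3
  ring_nf

lemma gaussDensity_scalar {s : ℝ} (hs : 0 < s) (w : 𝔼 (Fin d)) :
    gaussDensity (s • (1 : Matrix (Fin d) (Fin d) ℝ)) w
      = Real.exp (-(‖w‖ ^ 2 / (2 * s))) / (2 * Real.pi * s) ^ ((d : ℝ) / 2) := by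
  have h := IsElliptic.scalar (d := d) hs
  have h1 : qf (s • (1 : Matrix (Fin d) (Fin d) ℝ))⁻¹ w = ‖w‖ ^ 2 / s := by
    have := h.inv.lower w
    have := h.inv.upper w
    rw [div_eq_inv_mul]
    linarith
  have h2 : (2 * Real.pi) ^ d
      = (2 * Real.pi) ^ ((d : ℝ) / 2) * (2 * Real.pi) ^ ((d : ℝ) / 2) := by
    rw [← Real.rpow_add (by positivity), add_halves, Real.rpow_natCast]
  rw [gaussDensity, gaussMass_scalar hs, h1, h2, Real.div_rpow (by positivity) hs.le,
    Real.mul_rpow (by positivity) hs.le, div_div, mul_comm s 2]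
  have : (0 : ℝ) < (2 * Real.pi) ^ ((d : ℝ) / 2) := by positivity
  have : (0 : ℝ) < s ^ ((d : ℝ) / 2) := by positivity
  field_simp

namespace IsElliptic

variable {M M₁ M₂ : Matrix (Fin d) (Fin d) ℝ} {α β α₁ β₁ α₂ β₂ : ℝ}

/-- Monotonicity of the integrand, together with the dilation by `√c`, which turns the factor `c` in
the form into `c ^ (d / 2)`. -/
lemma gaussMass_le_of_le (h₁ : IsElliptic M₁ α₁ β₁) {c : ℝ} (hc : 0 < c)
    (h₂ : IsElliptic M₂ α₂ β₂)
    (h : ∀ w, qf M₁ w ≤ c * qf M₂ w) : gaussMass M₂ ≤ c ^ ((d : ℝ) / 2) * gaussMass M₁ := by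
  have h3 : gaussMass (c • M₂) ≤ gaussMass M₁ := by
    refine integral_mono (h₂.smul hc).integrable_exp h₁.integrable_exp fun ξ => ?_
    have := h ξ
    rw [← qf_smul] at this
    simp only
    gcongr
  have h4 : gaussMass (c • M₂) = (c ^ ((d : ℝ) / 2))⁻¹ * gaussMass M₂ := by
    have h5 := Measure.integral_comp_smul (volume : Measure (𝔼 (Fin d)))
      (fun ξ => Real.exp (-(qf M₂ ξ / 2))) (Real.sqrt c)
    simp_rw [qf_smul_right, Real.sq_sqrt hc.le] at h5
    simp_rw [gaussMass, qf_smul]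
    rw [h5, finrank_euclideanSpace_fin, smul_eq_mul, abs_of_nonneg (by positivity),
      Real.sqrt_eq_rpow, ← Real.rpow_natCast, ← Real.rpow_mul hc.le]
    congr 3
    ring
  rw [h4, inv_mul_le_iff₀ (by positivity)] at h3
  exact h3

lemma gaussDensity_le (h : IsElliptic M α β) (w : 𝔼 (Fin d)) :
    gaussDensity M w ≤ Real.exp (-(‖w‖ ^ 2 / (2 * β))) / (2 * Real.pi * α) ^ ((d : ℝ) / 2) := by
  have h1 : gaussMass M ≤ gaussMass (α • (1 : Matrix (Fin d) (Fin d) ℝ)) := by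
    have := (scalar (d := d) h.pos).gaussMass_le_of_le one_pos h
      (fun w => by rw [qf_smul, qf_one, one_mul]; exact h.lower w)
    simpa using this
  have h2 : qf (α • (1 : Matrix (Fin d) (Fin d) ℝ))⁻¹ 0 = 0 := by simp [qf]
  have h3 := gaussDensity_scalar (d := d) h.pos 0
  rw [gaussDensity, h2] at h3
  simp only [zero_div, neg_zero, Real.exp_zero, mul_one, norm_zero, ne_eq, OfNat.ofNat_ne_zero,
    not_false_eq_true, zero_pow] at h3
  rw [gaussDensity, div_eq_mul_one_div (Real.exp _), mul_comm, ← h3]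
  have h4 := h.inv.lower w
  have h5 : ‖w‖ ^ 2 / (2 * β) = β⁻¹ * ‖w‖ ^ 2 / 2 := by field_simp
  rw [h5]
  have := h.gaussMass_pos
  gcongr

lemma gaussDensity_le_const (h : IsElliptic M α β) (w : 𝔼 (Fin d)) :
    gaussDensity M w ≤ 1 / (2 * Real.pi * α) ^ ((d : ℝ) / 2) := by
  refine (h.gaussDensity_le w).trans ?_
  have := h.pos
  have := h.pos'
  gcongr
  rw [Real.exp_le_one_iff, neg_nonpos]
  positivity

/-- Moving the argument of a Gaussian density. -/
lemma gaussDensity_sub_gaussDensity_le (h : IsElliptic M α β) (v w : 𝔼 (Fin d)) :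
    gaussDensity M v - gaussDensity M w ≤
      ‖v - w‖ * (‖v‖ + ‖w‖) / (2 * α) *
        (Real.exp (-(‖v‖ ^ 2 / (2 * β))) / (2 * Real.pi * α) ^ ((d : ℝ) / 2)) := by
  have h1 := (abs_le.1 (h.abs_qf_inv_sub_le v w)).1
  -- The difference is `gaussDensity M v` times `1 - exp (-x)`, and `1 - exp (-x) ≤ x`.
  have h2 := Real.add_one_le_exp (-((qf M⁻¹ w - qf M⁻¹ v) / 2))
  have h3 : gaussDensity M w = gaussDensity M v * Real.exp (-((qf M⁻¹ w - qf M⁻¹ v) / 2)) := by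
    rw [gaussDensity, gaussDensity, mul_assoc _ (Real.exp _) (Real.exp _), ← Real.exp_add]
    congr 2
    ring
  have h4 := h.gaussDensity_pos v
  have h5 := h.gaussDensity_le v
  have hα := h.pos
  have h6 : (qf M⁻¹ w - qf M⁻¹ v) / 2 ≤ ‖v - w‖ * (‖v‖ + ‖w‖) / (2 * α) := by
    have : ‖v - w‖ * (‖v‖ + ‖w‖) / (2 * α) = ‖v - w‖ * (‖v‖ + ‖w‖) / α / 2 := by
      field_simp
    rw [this]
    linarith
  calc _ = gaussDensity M v * (1 - Real.exp (-((qf M⁻¹ w - qf M⁻¹ v) / 2))) := by rw [h3]; ring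
    _ ≤ gaussDensity M v * (‖v - w‖ * (‖v‖ + ‖w‖) / (2 * α)) := by
      gcongr; linarith
    _ ≤ _ := by
      rw [mul_comm]
      gcongr

lemma abs_gaussDensity_sub_gaussDensity_le (h : IsElliptic M α β) (v w : 𝔼 (Fin d)) {μ : ℝ}
    (hv : μ ≤ ‖v‖) (hw : μ ≤ ‖w‖) (hμ : 0 ≤ μ) :
    |gaussDensity M v - gaussDensity M w| ≤
      ‖v - w‖ * (‖v‖ + ‖w‖) / (2 * α) *
        (Real.exp (-(μ ^ 2 / (2 * β))) / (2 * Real.pi * α) ^ ((d : ℝ) / 2)) := by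
  have hα := h.pos
  have hβ := h.pos'
  have h1 := h.gaussDensity_sub_gaussDensity_le v w
  have h2 := h.gaussDensity_sub_gaussDensity_le w v
  rw [norm_sub_rev, add_comm] at h2
  rw [abs_le']
  constructor
  · refine h1.trans ?_
    gcongr
  · rw [neg_sub]
    refine h2.trans ?_
    gcongr

/-- Changing the covariance of a Gaussian density. -/
lemma gaussDensity_sub_le_of_le (h₁ : IsElliptic M₁ α β) (h₂ : IsElliptic M₂ α β) {ε : ℝ}
    (hε : 0 ≤ ε) (h : ∀ w, qf M₁ w ≤ (1 + ε) * qf M₂ w) (h' : ∀ w, qf M₂ w ≤ (1 + ε) * qf M₁ w)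
    (w : 𝔼 (Fin d)) :
    gaussDensity M₁ w - gaussDensity M₂ w ≤ ε / 2 * (d + ‖w‖ ^ 2 / α) *
        (Real.exp (-(‖w‖ ^ 2 / (2 * β))) / (2 * Real.pi * α) ^ ((d : ℝ) / 2)) := by
  have hc : 0 < 1 + ε := by linarith
  have hα := h₁.pos
  have hz := h₂.gaussMass_le_of_le hc h₁ h'
  have hq := h₁.qf_inv_le_of_le h₂ hc h w
  -- The masses contribute at most `exp (ε d / 2)` to the ratio of densities and the exponents at
  -- most `exp (ε ‖w‖² / (2α))`. Again `1 - exp (-x) ≤ x` finishes.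
  have hce : (1 + ε) ^ ((d : ℝ) / 2) ≤ Real.exp (ε * (d / 2)) := by
    rw [Real.exp_mul]
    refine Real.rpow_le_rpow hc.le ?_ (by positivity)
    have := Real.add_one_le_exp ε
    linarith
  have hz' : gaussMass M₁ * Real.exp (-(ε * (d / 2))) ≤ gaussMass M₂ := by
    rw [Real.exp_neg, ← div_eq_mul_inv, div_le_iff₀' (Real.exp_pos _)]
    exact hz.trans (mul_le_mul_of_nonneg_right hce h₂.gaussMass_pos.le)
  have hup := h₁.inv.upper w
  have hlow : gaussDensity M₁ w * Real.exp (-(ε / 2 * (d + ‖w‖ ^ 2 / α))) ≤ gaussDensity M₂ w := by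
    have e1 : gaussDensity M₁ w * Real.exp (-(ε / 2 * (d + ‖w‖ ^ 2 / α)))
        = ((2 * Real.pi) ^ d)⁻¹ * (gaussMass M₁ * Real.exp (-(ε * (d / 2)))) *
          Real.exp (-(qf M₁⁻¹ w / 2) - ε / 2 * (α⁻¹ * ‖w‖ ^ 2)) := by
      rw [gaussDensity]
      have : -(ε / 2 * (d + ‖w‖ ^ 2 / α)) = -(ε * (d / 2)) - ε / 2 * (α⁻¹ * ‖w‖ ^ 2) := by
        rw [div_eq_inv_mul]; ring
      rw [this, Real.exp_sub, Real.exp_sub]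
      ring
    rw [e1, gaussDensity]
    have := h₁.gaussMass_pos
    have : ε * qf M₁⁻¹ w ≤ ε * (α⁻¹ * ‖w‖ ^ 2) := by gcongr
    have := h₂.gaussMass_pos
    gcongr
    linarith
  have h4 := h₁.gaussDensity_pos w
  have h5 := h₁.gaussDensity_le w
  have h6 := Real.add_one_le_exp (-(ε / 2 * (d + ‖w‖ ^ 2 / α)))
  calc _ ≤ gaussDensity M₁ w * (1 - Real.exp (-(ε / 2 * (d + ‖w‖ ^ 2 / α)))) := by
        rw [mul_sub, mul_one]; linarith
    _ ≤ gaussDensity M₁ w * (ε / 2 * (d + ‖w‖ ^ 2 / α)) := by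
      gcongr; linarith
    _ ≤ _ := by
      rw [mul_comm]
      gcongr

lemma abs_gaussDensity_sub_le_of_le (h₁ : IsElliptic M₁ α β) (h₂ : IsElliptic M₂ α β) {ε : ℝ}
    (hε : 0 ≤ ε) (h : ∀ w, qf M₁ w ≤ (1 + ε) * qf M₂ w) (h' : ∀ w, qf M₂ w ≤ (1 + ε) * qf M₁ w)
    (w : 𝔼 (Fin d)) :
    |gaussDensity M₁ w - gaussDensity M₂ w| ≤ ε / 2 * (d + ‖w‖ ^ 2 / α) *
        (Real.exp (-(‖w‖ ^ 2 / (2 * β))) / (2 * Real.pi * α) ^ ((d : ℝ) / 2)) := by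
  rw [abs_le', neg_sub]
  exact ⟨h₁.gaussDensity_sub_le_of_le h₂ hε h h' w, h₂.gaussDensity_sub_le_of_le h₁ hε h' h w⟩

end IsElliptic

end

/-! ### The one-step parametrix kernel. -/

section

/-- Lowering the exponent from 1/2 to 1/8 leaves `exp (3u²/8)` to absorb the cubic; its second-order
Taylor bound suffices. This fourfold widening of the covariance is the source of `4 * lamHi` below.
-/
lemma cubic_mul_exp_le (u : ℝ) :
    (u + u ^ 3) * Real.exp (-(u ^ 2 / 2)) ≤ 4 * Real.exp (-(u ^ 2 / 8)) := by
  have h1 := Real.quadratic_le_exp_of_nonneg (x := 3 * u ^ 2 / 8) (by positivity)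
  have h2 : u + u ^ 3 ≤ 4 * Real.exp (3 * u ^ 2 / 8) := by
    nlinarith [sq_nonneg (u ^ 2 - 2 * u), sq_nonneg (u - 1), sq_nonneg (u ^ 2 - 4), sq_nonneg u,
      sq_nonneg (u - 2)]
  have h3 : Real.exp (-(u ^ 2 / 8)) = Real.exp (3 * u ^ 2 / 8) * Real.exp (-(u ^ 2 / 2)) := by
    rw [← Real.exp_add]; congr 1; ring
  rw [h3, ← mul_assoc]
  exact mul_le_mul_of_nonneg_right h2 (Real.exp_pos _).le

/-- Here `u` is a rescaled distance and `η` a rescaled drift displacement. The prefactor is absorbed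
by `exp (3η²/4 + u²/4)`, and `(u + η)² ≤ 2u² + 2η²` recentres the Gaussian at the cost `exp (η²)`.
-/
lemma add_mul_exp_le (u η : ℝ) :
    (u + η / 2) * Real.exp (-(u ^ 2 / 2))
      ≤ 2 * (Real.exp (η ^ 2) * Real.exp (-((u + η) ^ 2 / 8))) := by
  have h1 := Real.add_one_le_exp (3 / 4 * η ^ 2 + u ^ 2 / 4)
  have h2 : u + η / 2 ≤ 2 * Real.exp (3 / 4 * η ^ 2 + u ^ 2 / 4) := by
    nlinarith [sq_nonneg (u - 1), sq_nonneg (η - 1 / 6)]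
  have h3 : Real.exp (3 / 4 * η ^ 2 + u ^ 2 / 4) * Real.exp (-(u ^ 2 / 2))
      ≤ Real.exp (η ^ 2) * Real.exp (-((u + η) ^ 2 / 8)) := by
    rw [← Real.exp_add, ← Real.exp_add, Real.exp_le_exp]
    nlinarith [sq_nonneg (u - η)]
  calc _ ≤ 2 * Real.exp (3 / 4 * η ^ 2 + u ^ 2 / 4) * Real.exp (-(u ^ 2 / 2)) := by gcongr
    _ ≤ _ := by rw [mul_assoc]; gcongr

/-- The comparison constant of the one-step parametrix kernel. -/
noncomputable def kernelConst (d : ℕ) (B lamLo lamHi L₀ T : ℝ) : ℝ :=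
  2 * (Real.sqrt lamHi / lamLo * B * Real.exp (B ^ 2 * T / lamHi))
    + 4 * (d * L₀ * (lamHi / lamLo) ^ 2)

variable {a₀ a₁ : Matrix (Fin d) (Fin d) ℝ} {lamLo lamHi L₀ B T δ : ℝ}

lemma IsElliptic.mul_smul_add_smul (h₀ : IsElliptic a₀ lamLo lamHi)
    (h₁ : IsElliptic a₁ lamLo lamHi) (r : ℕ) (hδ : 0 < δ) :
    IsElliptic (((r : ℝ) * δ) • a₀ + δ • a₁) (lamLo * ((r + 1) * δ)) (lamHi * ((r + 1) * δ)) where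
  pos := by have := h₀.pos; positivity
  pos' := by have := h₀.pos'; positivity
  symm := by
    rw [Matrix.transpose_add, Matrix.transpose_smul, Matrix.transpose_smul, h₀.symm, h₁.symm]
  lower w := by
    rw [qf_add, qf_smul, qf_smul]
    have e0 := mul_le_mul_of_nonneg_left (h₀.lower w) (by positivity : 0 ≤ (r : ℝ) * δ)
    have e1 := mul_le_mul_of_nonneg_left (h₁.lower w) hδ.le
    linarith
  upper w := by
    rw [qf_add, qf_smul, qf_smul]
    have e0 := mul_le_mul_of_nonneg_left (h₀.upper w) (by positivity : 0 ≤ (r : ℝ) * δ)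
    have e1 := mul_le_mul_of_nonneg_left (h₁.upper w) hδ.le
    linarith

/-- Only one of the `r + 1` steps has a different covariance, so the forms differ by a relative
error `ε` of order `δ ‖w‖ / t`. On the Gaussian scale `‖w‖ ~ √t` this is `δ / √t`, a singularity
that is summable in time. -/
lemma abs_kernel_covariance_le (hd : 0 < d) (h₀ : IsElliptic a₀ lamLo lamHi)
    (h₁ : IsElliptic a₁ lamLo lamHi) (hlam : lamLo ≤ lamHi) (hL : 0 ≤ L₀) (w : 𝔼 (Fin d))
    (hD : ∀ ξ, |qf a₁ ξ - qf a₀ ξ| ≤ 2 * Real.sqrt lamHi * L₀ * ‖w‖ * ‖ξ‖ ^ 2)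
    (r : ℕ) (hδ : 0 < δ) {t : ℝ} (ht : t = (r + 1) * δ) :
    |gaussDensity (((r : ℝ) * δ) • a₀ + δ • a₁) w - gaussDensity (t • a₀) w| ≤
      δ / Real.sqrt t * (4 * (d * L₀ * (lamHi / lamLo) ^ 2)) *
        (Real.exp (-(‖w‖ ^ 2 / (8 * lamHi * t))) / (2 * Real.pi * (lamLo * t)) ^ ((d : ℝ) / 2)) := by
  have hlo := h₀.pos
  have hhi := h₀.pos'
  have htp : 0 < t := by rw [ht]; positivity
  have hM₁ := h₀.mul_smul_add_smul h₁ r hδ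
  rw [← ht] at hM₁
  have hM₀ : IsElliptic (t • a₀) (lamLo * t) (lamHi * t) := by
    have := h₀.smul htp
    rwa [mul_comm t, mul_comm t] at this
  set ε := δ * (2 * Real.sqrt lamHi * L₀ * ‖w‖) / (lamLo * t) with hε
  have hε0 : 0 ≤ ε := by positivity
  have hdiff : ∀ ξ, |qf (((r : ℝ) * δ) • a₀ + δ • a₁) ξ - qf (t • a₀) ξ|
      ≤ ε * (lamLo * t * ‖ξ‖ ^ 2) := fun ξ => by
    have e : qf (((r : ℝ) * δ) • a₀ + δ • a₁) ξ - qf (t • a₀) ξ = δ * (qf a₁ ξ - qf a₀ ξ) := by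
      rw [qf_add, qf_smul, qf_smul, qf_smul, ht]; ring
    rw [e, abs_mul, abs_of_pos hδ]
    have e2 : ε * (lamLo * t * ‖ξ‖ ^ 2) = δ * (2 * Real.sqrt lamHi * L₀ * ‖w‖ * ‖ξ‖ ^ 2) := by
      rw [hε]; field_simp
    rw [e2]
    exact mul_le_mul_of_nonneg_left (hD ξ) hδ.le
  have h := hM₁.abs_gaussDensity_sub_le_of_le hM₀ hε0
    (fun ξ => by
      have e1 := (abs_le.1 (hdiff ξ)).2
      have e2 := mul_le_mul_of_nonneg_left (hM₀.lower ξ) hε0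
      linarith)
    (fun ξ => by
      have e1 := (abs_le.1 (hdiff ξ)).1
      have e2 := mul_le_mul_of_nonneg_left (hM₁.lower ξ) hε0
      linarith) w
  refine h.trans ?_
  rw [mul_div_assoc', mul_div_assoc']
  gcongr ?_ / _
  set s := Real.sqrt lamHi with hs
  set q := Real.sqrt t with hq
  have hs0 : 0 < s := Real.sqrt_pos.2 hhi
  have hq0 : 0 < q := Real.sqrt_pos.2 htp
  have hs2 : lamHi = s ^ 2 := (Real.sq_sqrt hhi.le).symm
  have hq2 : t = q ^ 2 := (Real.sq_sqrt htp.le).symm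
  -- In the scale of the wide Gaussian the estimate reduces to the one-variable inequality
  -- `cubic_mul_exp_le`.
  set u := ‖w‖ / (s * q) with hu
  have hu0 : 0 ≤ u := by positivity
  have hw : ‖w‖ = u * (s * q) := by rw [hu]; field_simp
  have hexp1 : ‖w‖ ^ 2 / (2 * (lamHi * t)) = u ^ 2 / 2 := by
    rw [hw, hs2, hq2]; field_simp
  have hexp2 : ‖w‖ ^ 2 / (8 * lamHi * t) = u ^ 2 / 8 := by
    rw [hw, hs2, hq2]; field_simp
  have hcoef : ε / 2 * (d + ‖w‖ ^ 2 / (lamLo * t))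
      = δ / q * L₀ * (lamHi / lamLo) * (u * (d + lamHi / lamLo * u ^ 2)) := by
    rw [hε, hw, hs2, hq2]; field_simp
  have hkap : 1 ≤ lamHi / lamLo := (one_le_div hlo).2 hlam
  have hd1 : (1 : ℝ) ≤ d := by exact_mod_cast hd
  have hpoly : u * (d + lamHi / lamLo * u ^ 2) ≤ lamHi / lamLo * d * (u + u ^ 3) := by
    have e1 : (d : ℝ) * u ≤ lamHi / lamLo * d * u :=
      mul_le_mul_of_nonneg_right (le_mul_of_one_le_left (by positivity) hkap) hu0
    have e2 : lamHi / lamLo * u ^ 3 ≤ lamHi / lamLo * d * u ^ 3 :=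
      mul_le_mul_of_nonneg_right (le_mul_of_one_le_right (by positivity) hd1) (by positivity)
    linarith
  rw [hexp1, hexp2, hcoef]
  calc _ ≤ δ / q * L₀ * (lamHi / lamLo) * (lamHi / lamLo * d * (u + u ^ 3))
        * Real.exp (-(u ^ 2 / 2)) := by gcongr
    _ = δ / q * (d * L₀ * (lamHi / lamLo) ^ 2) * ((u + u ^ 3) * Real.exp (-(u ^ 2 / 2))) := by ring
    _ ≤ δ / q * (d * L₀ * (lamHi / lamLo) ^ 2) * (4 * Real.exp (-(u ^ 2 / 8))) := by
      exact mul_le_mul_of_nonneg_left (cubic_mul_exp_le u) (by positivity)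
    _ = _ := by ring

/-- A displacement of length at most `δ * B` meets a Gaussian whose logarithmic gradient is of order
`‖w‖ / t`, hence again `δ / √t` after absorption. -/
lemma abs_kernel_drift_le {M : Matrix (Fin d) (Fin d) ℝ} {t : ℝ}
    (hM : IsElliptic M (lamLo * t) (lamHi * t)) (hlo : 0 < lamLo) (hhi : 0 < lamHi) (hδ : 0 < δ)
    (hδT : δ ≤ T) (hδt : δ ≤ t) (w b : 𝔼 (Fin d)) (hb : ‖b‖ ≤ B) :
    |gaussDensity M (w - δ • b) - gaussDensity M w| ≤
      δ / Real.sqrt t * (2 * (Real.sqrt lamHi / lamLo * B * Real.exp (B ^ 2 * T / lamHi))) *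
        (Real.exp (-(‖w‖ ^ 2 / (8 * lamHi * t))) / (2 * Real.pi * (lamLo * t)) ^ ((d : ℝ) / 2)) := by
  have htp : 0 < t := hδ.trans_le hδt
  have hB : 0 ≤ B := (norm_nonneg b).trans hb
  have hvw : ‖w - δ • b - w‖ ≤ δ * B := by
    rw [show w - δ • b - w = -(δ • b) by abel, norm_neg, norm_smul, Real.norm_eq_abs,
      abs_of_pos hδ]
    gcongr
  have h1 : ‖w‖ ≤ ‖w - δ • b‖ + δ * B := by
    have := norm_sub_norm_le w (w - δ • b)
    rw [norm_sub_rev w (w - δ • b)] at this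
    linarith
  have h2 : ‖w - δ • b‖ ≤ ‖w‖ + δ * B := by
    have := norm_sub_norm_le (w - δ • b) w
    linarith
  -- `μ` is the smaller of the two norms, so one exponential bounds both densities; the other norm
  -- exceeds it by at most `δ * B`.
  obtain ⟨μ, hμ0, hμv, hμw, hsum, hwμ⟩ : ∃ μ, 0 ≤ μ ∧ μ ≤ ‖w - δ • b‖ ∧ μ ≤ ‖w‖ ∧
      ‖w - δ • b‖ + ‖w‖ ≤ 2 * μ + δ * B ∧ ‖w‖ ≤ μ + δ * B := by
    have := norm_nonneg w
    have := norm_nonneg (w - δ • b)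
    have : 0 ≤ δ * B := by positivity
    rcases le_total ‖w‖ ‖w - δ • b‖ with h | h
    · exact ⟨‖w‖, by assumption, h, le_rfl, by linarith, by linarith⟩
    · exact ⟨‖w - δ • b‖, by assumption, le_rfl, h, by linarith, by linarith⟩
  refine (hM.abs_gaussDensity_sub_gaussDensity_le _ _ hμv hμw hμ0).trans ?_
  rw [mul_div_assoc', mul_div_assoc']
  gcongr ?_ / _
  set s := Real.sqrt lamHi with hs
  set q := Real.sqrt t with hq
  have hs0 : 0 < s := Real.sqrt_pos.2 hhi
  have hq0 : 0 < q := Real.sqrt_pos.2 htp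
  have hs2 : lamHi = s ^ 2 := (Real.sq_sqrt hhi.le).symm
  have hq2 : t = q ^ 2 := (Real.sq_sqrt htp.le).symm
  set u := μ / (s * q) with hu
  set η := δ * B / (s * q) with hη
  have hu0 : 0 ≤ u := by positivity
  have hη0 : 0 ≤ η := by positivity
  have hμ : μ = u * (s * q) := by rw [hu]; field_simp
  have hδB : δ * B = η * (s * q) := by rw [hη]; field_simp
  have hexp1 : μ ^ 2 / (2 * (lamHi * t)) = u ^ 2 / 2 := by
    rw [hμ, hs2, hq2]; field_simp
  have hexp2 : ‖w‖ ^ 2 / (8 * lamHi * t) ≤ (u + η) ^ 2 / 8 := by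
    have : (u + η) ^ 2 / 8 = (μ + δ * B) ^ 2 / (8 * lamHi * t) := by
      rw [hμ, hδB, hs2, hq2]; field_simp
    rw [this]
    gcongr
  -- The source of the factor `exp (B² T / lamHi)`: of the two factors `δ`, one is cancelled by `t ≥
  -- δ` and the other is at most `T`.
  have hη2 : η ^ 2 ≤ B ^ 2 * T / lamHi := by
    have : η ^ 2 = B ^ 2 * (δ * (δ / t)) / lamHi := by
      rw [hη, hs2, hq2]; field_simp
    rw [this]
    gcongr
    calc δ * (δ / t) ≤ δ * 1 := by gcongr; exact (div_le_one htp).2 hδt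
      _ ≤ T := by linarith
  calc _ ≤ δ * B * (2 * μ + δ * B) / (2 * (lamLo * t)) * Real.exp (-(μ ^ 2 / (2 * (lamHi * t)))) := by
        gcongr
    _ = δ / q * (s / lamLo * B) * ((u + η / 2) * Real.exp (-(u ^ 2 / 2))) := by
      rw [hexp1]
      have : δ * B * (2 * μ + δ * B) / (2 * (lamLo * t)) = δ / q * (s / lamLo * B) * (u + η / 2) := by
        rw [hδB, hμ, hq2]
        have : B = η * (s * q) / δ := by rw [← hδB]; field_simp
        rw [this]
        field_simp
      rw [this]; ring
    _ ≤ δ / q * (s / lamLo * B) * (2 * (Real.exp (η ^ 2) * Real.exp (-((u + η) ^ 2 / 8)))) := by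
      gcongr ?_ * ?_
      exact add_mul_exp_le u η
    _ ≤ δ / q * (s / lamLo * B) *
        (2 * (Real.exp (B ^ 2 * T / lamHi) * Real.exp (-(‖w‖ ^ 2 / (8 * lamHi * t))))) := by
      gcongr
    _ = _ := by ring

/-- The bound of the one-step parametrix kernel. -/
lemma abs_kernel_le (hd : 0 < d) (h₀ : IsElliptic a₀ lamLo lamHi)
    (h₁ : IsElliptic a₁ lamLo lamHi) (hlam : lamLo ≤ lamHi) (hL : 0 ≤ L₀) (w b : 𝔼 (Fin d))
    (hD : ∀ ξ, |qf a₁ ξ - qf a₀ ξ| ≤ 2 * Real.sqrt lamHi * L₀ * ‖w‖ * ‖ξ‖ ^ 2)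
    (hb : ‖b‖ ≤ B) (r : ℕ) (hδ : 0 < δ) (hδT : δ ≤ T) {t : ℝ} (ht : t = (r + 1) * δ) :
    |gaussDensity (((r : ℝ) * δ) • a₀ + δ • a₁) (w - δ • b) - gaussDensity (t • a₀) w| ≤
      δ / Real.sqrt t * kernelConst d B lamLo lamHi L₀ T *
        (Real.exp (-(‖w‖ ^ 2 / (8 * lamHi * t))) / (2 * Real.pi * (lamLo * t)) ^ ((d : ℝ) / 2)) := by
  have hM₁ := h₀.mul_smul_add_smul h₁ r hδ
  rw [← ht] at hM₁
  have e1 := abs_kernel_drift_le hM₁ h₀.pos h₀.pos' hδ hδT (by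
    rw [ht, add_mul, one_mul]; exact le_add_of_nonneg_left (by positivity)) w b hb
  have e2 := abs_kernel_covariance_le hd h₀ h₁ hlam hL w hD r hδ ht
  refine (abs_sub_le _ (gaussDensity (((r : ℝ) * δ) • a₀ + δ • a₁) w) _).trans
    ((add_le_add e1 e2).trans_eq ?_)
  rw [kernelConst]
  ring

end

/-! ### Beta integrals, the Mittag-Leffler series and the discrete Volterra inequality. -/

section

lemma integral_beta {u v : ℝ} (hu : 0 < u) (hv : 0 < v) :
    IntervalIntegrable (fun x : ℝ => x ^ (u - 1) * (1 - x) ^ (v - 1)) volume 0 1 ∧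
    ∫ x in (0 : ℝ)..1, x ^ (u - 1) * (1 - x) ^ (v - 1)
      = Real.Gamma u * Real.Gamma v / Real.Gamma (u + v) := by
  have hc := Complex.betaIntegral_convergent (u := u) (v := v) (by simpa) (by simpa)
  have e : ∀ x ∈ Set.uIoc (0 : ℝ) 1, ((x : ℂ) ^ ((u : ℂ) - 1) * (1 - (x : ℂ)) ^ ((v : ℂ) - 1))
      = ((x ^ (u - 1) * (1 - x) ^ (v - 1) : ℝ) : ℂ) := fun x hx => by
    rw [Set.uIoc_of_le zero_le_one] at hx
    push_cast
    rw [Complex.ofReal_cpow hx.1.le, Complex.ofReal_cpow (by linarith [hx.2])]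
    push_cast
    rfl
  have hc' : IntervalIntegrable (fun x : ℝ => ((x ^ (u - 1) * (1 - x) ^ (v - 1) : ℝ) : ℂ))
      volume 0 1 := hc.congr (fun x hx => e x hx)
  refine ⟨?_, ?_⟩
  · rw [intervalIntegrable_iff] at hc' ⊢
    simpa only [IntegrableOn, RCLike.re_to_complex, Complex.ofReal_re] using hc'.re
  · have h1 := Complex.betaIntegral_eq_Gamma_mul_div (u : ℂ) v (by simpa) (by simpa)
    rw [Complex.betaIntegral, intervalIntegral.integral_congr_ae (Filter.Eventually.of_forall e),
      intervalIntegral.integral_ofReal] at h1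
    rw [← Complex.ofReal_add, Complex.Gamma_ofReal, Complex.Gamma_ofReal, Complex.Gamma_ofReal] at h1
    exact_mod_cast h1

/-- Riemann sums of the Beta integrand from the left are below the integral. -/
lemma sum_sqrt_pow_div_le (n k : ℕ) :
    ∑ i ∈ Finset.range n, 1 / (n : ℝ) * (Real.sqrt (i / n) ^ k / Real.sqrt (1 - i / n))
      ≤ Real.sqrt Real.pi * Real.Gamma (1 + (k : ℝ) / 2) / Real.Gamma (1 + ((k + 1 : ℕ) : ℝ) / 2) := by
  rcases Nat.eq_zero_or_pos n with rfl | hn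
  · have := Real.Gamma_pos_of_pos (by positivity : 0 < 1 + (k : ℝ) / 2)
    have := Real.Gamma_pos_of_pos (by positivity : 0 < 1 + ((k + 1 : ℕ) : ℝ) / 2)
    simp only [Finset.range_zero, Finset.sum_empty]
    positivity
  obtain ⟨hi, hv⟩ := integral_beta (by positivity : 0 < 1 + (k : ℝ) / 2) (by norm_num : (0 : ℝ) < 1 / 2)
  have hn0 : (0 : ℝ) < n := by exact_mod_cast hn
  have hrhs : Real.sqrt Real.pi * Real.Gamma (1 + (k : ℝ) / 2) / Real.Gamma (1 + ((k + 1 : ℕ) : ℝ) / 2)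
      = Real.Gamma (1 + (k : ℝ) / 2) * Real.Gamma (1 / 2) / Real.Gamma (1 + (k : ℝ) / 2 + 1 / 2) := by
    rw [Real.Gamma_one_half_eq, mul_comm]
    congr 2
    push_cast
    ring
  rw [hrhs, ← hv]
  set g : ℝ → ℝ := fun x => x ^ (1 + (k : ℝ) / 2 - 1) * (1 - x) ^ ((1 : ℝ) / 2 - 1) with hg
  have hsub : ∀ i < n, IntervalIntegrable g volume (((i : ℕ) : ℝ) / n) (((i + 1 : ℕ) : ℝ) / n) := by
    intro i hin
    refine hi.mono_set ?_
    rw [Set.uIcc_of_le zero_le_one, Set.uIcc_of_le (by gcongr; simp)]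
    refine Set.Icc_subset_Icc (by positivity) ?_
    rw [div_le_one hn0]
    exact_mod_cast hin
  have hsum := intervalIntegral.sum_integral_adjacent_intervals (μ := volume) (f := g)
    (a := fun i : ℕ => (i : ℝ) / n) (n := n) hsub
  simp only [Nat.cast_zero, zero_div, div_self hn0.ne'] at hsum
  rw [← hsum]
  refine Finset.sum_le_sum fun i hin => ?_
  rw [Finset.mem_range] at hin
  have hin' : ((i + 1 : ℕ) : ℝ) ≤ n := by exact_mod_cast hin
  have hlen : ((i + 1 : ℕ) : ℝ) / n - (i : ℝ) / n = 1 / n := by push_cast; ring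
  rw [← hlen, ← smul_eq_mul, ← intervalIntegral.integral_const]
  -- The integrand increases on `[0, 1)`, so its left endpoint value is a lower bound. The
  -- comparison is restricted to the open interval because at `x = 1` the singular factor takes the
  -- default value 0.
  refine intervalIntegral.integral_mono_on_of_le_Ioo (by gcongr; simp) (by simp)
    (hsub i hin) fun x hx => ?_
  have hx0 : 0 ≤ (i : ℝ) / n := by positivity
  have hx1 : x < 1 := hx.2.trans_le ((div_le_one hn0).2 hin')
  have e1 : x ^ (1 + (k : ℝ) / 2 - 1) = Real.sqrt x ^ k := by
    rw [Real.sqrt_eq_rpow, ← Real.rpow_natCast, ← Real.rpow_mul (hx0.trans hx.1.le)]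
    congr 1; ring
  have e2 : (1 - x) ^ ((1 : ℝ) / 2 - 1) = (Real.sqrt (1 - x))⁻¹ := by
    rw [Real.sqrt_eq_rpow, ← Real.rpow_neg (by linarith)]
    congr 1; norm_num
  simp only [hg]
  rw [e1, e2, ← div_eq_mul_inv]
  have := hx.1.le
  have : 0 < Real.sqrt (1 - x) := Real.sqrt_pos.2 (by linarith)
  gcongr

/-- Passing from `j` to `j + 1` multiplies the left side by `j + 1` and the right side by `j + 3 /
2`. -/
lemma factorial_le_Gamma (j : ℕ) :
    Real.Gamma (3 / 2) * (j.factorial : ℝ) ≤ Real.Gamma ((j : ℝ) + 3 / 2) := by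
  induction j with
  | zero => simp
  | succ j ih =>
    have e : ((j + 1 : ℕ) : ℝ) + 3 / 2 = ((j : ℝ) + 3 / 2) + 1 := by push_cast; ring
    rw [e, Real.Gamma_add_one (by positivity), Nat.factorial_succ]
    push_cast
    have h3 := Real.Gamma_pos_of_pos (by norm_num : (0 : ℝ) < 3 / 2)
    calc _ = ((j : ℝ) + 1) * (Real.Gamma (3 / 2) * (j.factorial : ℝ)) := by ring
      _ ≤ _ := by gcongr; norm_num

lemma summable_pow_div_Gamma_even (x : ℝ) :
    Summable fun j : ℕ => x ^ (2 * j) / Real.Gamma (1 + ((2 * j : ℕ) : ℝ) / 2) := by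
  refine (Real.summable_pow_div_factorial (x ^ 2)).congr fun j => ?_
  have e : 1 + ((2 * j : ℕ) : ℝ) / 2 = (j : ℝ) + 1 := by push_cast; ring
  rw [e, Real.Gamma_nat_eq_factorial, pow_mul]

lemma summable_pow_div_Gamma_odd (x : ℝ) :
    Summable fun j : ℕ => x ^ (2 * j + 1) / Real.Gamma (1 + ((2 * j + 1 : ℕ) : ℝ) / 2) := by
  have h3 := Real.Gamma_pos_of_pos (by norm_num : (0 : ℝ) < 3 / 2)
  refine Summable.of_norm_bounded
    ((Real.summable_pow_div_factorial (x ^ 2)).mul_left (|x| / Real.Gamma (3 / 2))) fun j => ?_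
  have e : 1 + ((2 * j + 1 : ℕ) : ℝ) / 2 = (j : ℝ) + 3 / 2 := by push_cast; ring
  have hj := factorial_le_Gamma j
  have hjp : (0 : ℝ) < j.factorial := by exact_mod_cast j.factorial_pos
  have hG : 0 < Real.Gamma ((j : ℝ) + 3 / 2) := Real.Gamma_pos_of_pos (by positivity)
  have h0 : 0 ≤ (x ^ 2) ^ j := by positivity
  rw [e, Real.norm_eq_abs, abs_div, abs_of_pos hG, pow_succ, abs_mul, pow_mul,
    abs_of_nonneg h0, div_mul_div_comm, mul_comm |x|]
  exact div_le_div_of_nonneg_left (mul_nonneg h0 (abs_nonneg x)) (mul_pos h3 hjp) hj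

/-- Split by parity: the even terms are the exponential series of `x ^ 2`, and the odd ones are
dominated by a multiple of it. -/
lemma summable_pow_div_Gamma (x : ℝ) :
    Summable fun k : ℕ => x ^ k / Real.Gamma (1 + (k : ℝ) / 2) :=
  (HasSum.even_add_odd (f := fun k : ℕ => x ^ k / Real.Gamma (1 + (k : ℝ) / 2))
    (summable_pow_div_Gamma_even x).hasSum (summable_pow_div_Gamma_odd x).hasSum).summable

/-- The Mittag-Leffler function of order one half, in the form in which it solves the singular
Volterra equation. -/
noncomputable def mittagLeffler (x : ℝ) : ℝ := ∑' k : ℕ, x ^ k / Real.Gamma (1 + (k : ℝ) / 2)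

lemma mittagLeffler_zero : mittagLeffler 0 = 1 := by
  rw [mittagLeffler, tsum_eq_single 0]
  · simp
  · intro k hk; simp [hk]

lemma mittagLeffler_nonneg {x : ℝ} (hx : 0 ≤ x) : 0 ≤ mittagLeffler x :=
  tsum_nonneg fun k => div_nonneg (pow_nonneg hx k) (Real.Gamma_pos_of_pos (by positivity)).le

lemma mittagLeffler_mono {x y : ℝ} (hx : 0 ≤ x) (hxy : x ≤ y) :
    mittagLeffler x ≤ mittagLeffler y := by
  refine (summable_pow_div_Gamma x).tsum_le_tsum (fun k => ?_) (summable_pow_div_Gamma y)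
  have : 0 < Real.Gamma (1 + (k : ℝ) / 2) := Real.Gamma_pos_of_pos (by positivity)
  gcongr

/-- A supersolution of the discrete singular Volterra equation. -/
lemma one_add_sum_mittagLeffler_le {c δ : ℝ} (hc : 0 ≤ c) (hδ : 0 < δ) (n : ℕ) :
    1 + ∑ i ∈ Finset.range n, δ / Real.sqrt (((n : ℝ) - i) * δ) * c *
        mittagLeffler (Real.sqrt Real.pi * c * Real.sqrt (i * δ))
      ≤ mittagLeffler (Real.sqrt Real.pi * c * Real.sqrt (n * δ)) := by
  rcases Nat.eq_zero_or_pos n with rfl | hn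
  · simp [mittagLeffler_zero]
  have hn0 : (0 : ℝ) < n := by exact_mod_cast hn
  set θ := Real.sqrt Real.pi * c with hθ
  have hpi : 0 < Real.sqrt Real.pi := Real.sqrt_pos.2 Real.pi_pos
  have hθ0 : 0 ≤ θ := by positivity
  set q := Real.sqrt (n * δ) with hq
  have hq0 : 0 < q := Real.sqrt_pos.2 (by positivity)
  have hq2 : n * δ = q ^ 2 := (Real.sq_sqrt (by positivity)).symm
  have hS : ∀ i : ℕ, Summable fun k : ℕ =>
      δ / Real.sqrt (((n : ℝ) - i) * δ) * c *
        ((θ * Real.sqrt (i * δ)) ^ k / Real.Gamma (1 + (k : ℝ) / 2)) := fun i =>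
    (summable_pow_div_Gamma _).mul_left _
  have e1 : ∑ i ∈ Finset.range n, δ / Real.sqrt (((n : ℝ) - i) * δ) * c *
        mittagLeffler (θ * Real.sqrt (i * δ))
      = ∑' k : ℕ, ∑ i ∈ Finset.range n, δ / Real.sqrt (((n : ℝ) - i) * δ) * c *
        ((θ * Real.sqrt (i * δ)) ^ k / Real.Gamma (1 + (k : ℝ) / 2)) := by
    rw [Summable.tsum_finsetSum fun i _ => hS i]
    simp_rw [mittagLeffler, tsum_mul_left]
  rw [e1, mittagLeffler, (summable_pow_div_Gamma (θ * q)).tsum_eq_zero_add]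
  have e0 : (θ * q) ^ 0 / Real.Gamma (1 + ((0 : ℕ) : ℝ) / 2) = 1 := by simp
  rw [e0]
  refine add_le_add le_rfl (Summable.tsum_le_tsum (fun k => ?_) (summable_sum fun i _ => hS i)
    ((summable_nat_add_iff 1).2 (summable_pow_div_Gamma (θ * q))))
  have hG : 0 < Real.Gamma (1 + (k : ℝ) / 2) := Real.Gamma_pos_of_pos (by positivity)
  have hG' : 0 < Real.Gamma (1 + ((k + 1 : ℕ) : ℝ) / 2) := Real.Gamma_pos_of_pos (by positivity)
  -- By homogeneity in `n * δ = q ^ 2`, the powers of `q` come out and a Riemann sum on the grid `i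
  -- / n` remains. Its Beta value cancels `Γ(1 + k/2)` and produces the term of index `k + 1`; the
  -- term of index 0 is the leading 1.
  have e2 : ∀ i ∈ Finset.range n, δ / Real.sqrt (((n : ℝ) - i) * δ) * c *
        ((θ * Real.sqrt (i * δ)) ^ k / Real.Gamma (1 + (k : ℝ) / 2))
      = c * q * (θ * q) ^ k / Real.Gamma (1 + (k : ℝ) / 2) *
        (1 / (n : ℝ) * (Real.sqrt (i / n) ^ k / Real.sqrt (1 - i / n))) := fun i hi => by
    have hin : (i : ℝ) < n := by exact_mod_cast Finset.mem_range.1 hi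
    have a1 : ((n : ℝ) - i) * δ = (n * δ) * (1 - i / n) := by field_simp
    have a2 : (i : ℝ) * δ = (n * δ) * (i / n) := by field_simp
    have a3 : 0 < 1 - (i : ℝ) / n := by rw [sub_pos, div_lt_one hn0]; exact hin
    have a4 : 0 < Real.sqrt (1 - (i : ℝ) / n) := Real.sqrt_pos.2 a3
    have a5 : δ = q ^ 2 / n := by rw [← hq2]; field_simp
    rw [a1, a2, Real.sqrt_mul (x := n * δ) (by positivity),
      Real.sqrt_mul (x := n * δ) (by positivity), ← hq]
    rw [← mul_assoc θ q, mul_pow (θ * q), a5]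
    field_simp
  rw [Finset.sum_congr rfl e2, ← Finset.mul_sum]
  calc _ ≤ c * q * (θ * q) ^ k / Real.Gamma (1 + (k : ℝ) / 2) *
        (Real.sqrt Real.pi * Real.Gamma (1 + (k : ℝ) / 2) / Real.Gamma (1 + ((k + 1 : ℕ) : ℝ) / 2)) := by
        gcongr
        exact sum_sqrt_pow_div_le n k
    _ = (θ * q) ^ (k + 1) / Real.Gamma (1 + ((k + 1 : ℕ) : ℝ) / 2) := by
      rw [pow_succ, hθ]; field_simp

end

/-! ### Abstract chains with Gaussian transitions. -/

section

/-- The Fourier representation expresses the density through the form of `M x` itself, so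
measurability of the inverse matrix and of the mass never has to be treated. -/
lemma measurable_gaussDensity_comp {X : Type*} [MeasurableSpace X]
    {M : X → Matrix (Fin d) (Fin d) ℝ} {v : X → 𝔼 (Fin d)} {α β : ℝ}
    (hM : ∀ x, IsElliptic (M x) α β)
    (hq : Measurable fun p : X × 𝔼 (Fin d) => qf (M p.1) p.2) (hv : Measurable v) :
    Measurable fun x => gaussDensity (M x) (v x) := by
  have h1 : StronglyMeasurable fun x => ∫ ξ : 𝔼 (Fin d),
      Complex.exp (-(qf (M x) ξ / 2 : ℝ) + Complex.I * (inner ℝ (v x) ξ : ℝ)) := by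
    refine StronglyMeasurable.integral_prod_right' (f := fun (p : X × 𝔼 (Fin d)) =>
      Complex.exp (-(qf (M p.1) p.2 / 2 : ℝ) + Complex.I * (inner ℝ (v p.1) p.2 : ℝ))) ?_
    have : Measurable fun p : X × 𝔼 (Fin d) => inner ℝ (v p.1) p.2 :=
      (hv.comp measurable_fst).inner measurable_snd
    exact Measurable.stronglyMeasurable (by fun_prop)
  have h2 : (fun x => gaussDensity (M x) (v x)) = fun x => ((((2 * Real.pi) ^ d)⁻¹ : ℝ) *
      ∫ ξ : 𝔼 (Fin d),
        Complex.exp (-(qf (M x) ξ / 2 : ℝ) + Complex.I * (inner ℝ (v x) ξ : ℝ))).re := by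
    ext x
    rw [← (hM x).gaussDensity_eq, Complex.ofReal_re]
  rw [h2]
  have := h1.measurable
  fun_prop

/-- A sequence of laws evolving through Gaussian transitions with mean `z + δ b z` and
covariance `δ a z`. -/
structure IsGaussianChain (a : 𝔼 (Fin d) → Matrix (Fin d) (Fin d) ℝ) (b : 𝔼 (Fin d) → 𝔼 (Fin d))
    (δ lamLo lamHi : ℝ) (μ : ℕ → Measure (𝔼 (Fin d))) : Prop where
  elliptic : ∀ z, IsElliptic (a z) lamLo lamHi
  measurable_qf : Measurable fun p : 𝔼 (Fin d) × 𝔼 (Fin d) => qf (a p.1) p.2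
  measurable_drift : Measurable b
  step_pos : 0 < δ
  prob : ∀ n, IsProbabilityMeasure (μ n)
  lintegral_succ : ∀ (n : ℕ) (f : 𝔼 (Fin d) → ENNReal), Measurable f →
    ∫⁻ y, f y ∂(μ (n + 1)) = ∫⁻ z, ∫⁻ y, f y ∂(gaussMeasure (z + δ • b z) (δ • a z)) ∂(μ n)

/-- The density after one Gaussian transition from the law `μ`. -/
noncomputable def stepDensity (a : 𝔼 (Fin d) → Matrix (Fin d) (Fin d) ℝ)
    (b : 𝔼 (Fin d) → 𝔼 (Fin d)) (δ : ℝ) (μ : Measure (𝔼 (Fin d))) (y : 𝔼 (Fin d)) : ℝ :=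
  ∫ z, gaussDensity (δ • a z) (y - z - δ • b z) ∂μ

lemma IsElliptic.integrable_gaussDensity_sub {M : Matrix (Fin d) (Fin d) ℝ} {α β : ℝ}
    (h : IsElliptic M α β) (ν : Measure (𝔼 (Fin d))) [IsFiniteMeasure ν] (y : 𝔼 (Fin d)) :
    Integrable (fun z => gaussDensity M (y - z)) ν := by
  refine Integrable.of_bound (C := 1 / (2 * Real.pi * α) ^ ((d : ℝ) / 2)) ?_
    (Filter.Eventually.of_forall fun z => ?_)
  · exact ((IsElliptic.continuous_gaussDensity M).comp (by fun_prop)).aestronglyMeasurable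
  · rw [Real.norm_eq_abs, abs_of_pos (h.gaussDensity_pos _)]
    exact h.gaussDensity_le_const _

namespace IsGaussianChain

variable {a : 𝔼 (Fin d) → Matrix (Fin d) (Fin d) ℝ} {b : 𝔼 (Fin d) → 𝔼 (Fin d)}
  {δ lamLo lamHi : ℝ} {μ : ℕ → Measure (𝔼 (Fin d))}

lemma measurable_density (h : IsGaussianChain a b δ lamLo lamHi μ) {M : Matrix (Fin d) (Fin d) ℝ}
    {α β : ℝ} (hM : ∀ z, IsElliptic (M + δ • a z) α β) :
    Measurable fun p : 𝔼 (Fin d) × 𝔼 (Fin d) =>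
      gaussDensity (M + δ • a p.1) (p.2 - p.1 - δ • b p.1) := by
  have hb := h.measurable_drift
  have h1 : Measurable fun p : (𝔼 (Fin d) × 𝔼 (Fin d)) × 𝔼 (Fin d) => qf M p.2 :=
    (continuous_qf M).measurable.comp measurable_snd
  have h2 : Measurable fun p : (𝔼 (Fin d) × 𝔼 (Fin d)) × 𝔼 (Fin d) => qf (a p.1.1) p.2 := by
    have e : Measurable fun p : (𝔼 (Fin d) × 𝔼 (Fin d)) × 𝔼 (Fin d) => (p.1.1, p.2) := by fun_prop
    have e' := h.measurable_qf.comp e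
    exact e'
  have h3 : Measurable fun p : 𝔼 (Fin d) × 𝔼 (Fin d) => p.2 - p.1 - δ • b p.1 :=
    (measurable_snd.sub measurable_fst).sub ((hb.comp measurable_fst).const_smul δ)
  refine measurable_gaussDensity_comp (M := fun p : 𝔼 (Fin d) × 𝔼 (Fin d) => M + δ • a p.1)
    (fun p => hM p.1) ?_ h3
  simp_rw [qf_add, qf_smul]
  exact h1.add (h2.const_mul δ)

lemma integrable_density (h : IsGaussianChain a b δ lamLo lamHi μ) {M : Matrix (Fin d) (Fin d) ℝ}
    {α β : ℝ} (hM : ∀ z, IsElliptic (M + δ • a z) α β) (n : ℕ) (y : 𝔼 (Fin d)) :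
    Integrable (fun z => gaussDensity (M + δ • a z) (y - z - δ • b z)) (μ n) := by
  have := h.prob n
  refine Integrable.of_bound (C := 1 / (2 * Real.pi * α) ^ ((d : ℝ) / 2)) ?_
    (Filter.Eventually.of_forall fun z => ?_)
  · exact ((h.measurable_density hM).comp (measurable_id.prodMk measurable_const)).aestronglyMeasurable
  · rw [Real.norm_eq_abs, abs_of_pos ((hM z).gaussDensity_pos _)]
    exact (hM z).gaussDensity_le_const _

/-- Allows the results stated for `M + δ • a z` to be used with `M = 0`, no frozen step, although 0
is not elliptic. -/
lemma zero_add_elliptic (h : IsGaussianChain a b δ lamLo lamHi μ) (z : 𝔼 (Fin d)) :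
    IsElliptic (0 + δ • a z) (δ * lamLo) (δ * lamHi) := by
  rw [zero_add]; exact (h.elliptic z).smul h.step_pos

lemma stepDensity_nonneg (h : IsGaussianChain a b δ lamLo lamHi μ) (n : ℕ) (y : 𝔼 (Fin d)) :
    0 ≤ stepDensity a b δ (μ n) y :=
  integral_nonneg fun z => (((h.elliptic z).smul h.step_pos).gaussDensity_pos _).le

lemma continuous_stepDensity (h : IsGaussianChain a b δ lamLo lamHi μ) (n : ℕ) :
    Continuous (stepDensity a b δ (μ n)) := by
  have := h.prob n
  refine continuous_of_dominated (bound := fun _ => 1 / (2 * Real.pi * (δ * lamLo)) ^ ((d : ℝ) / 2))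
    (fun y => ?_) (fun y => Filter.Eventually.of_forall fun z => ?_) (integrable_const _)
    (Filter.Eventually.of_forall fun z => ?_)
  · simpa using (h.integrable_density h.zero_add_elliptic n y).aestronglyMeasurable
  · have e := (h.elliptic z).smul h.step_pos
    rw [Real.norm_eq_abs, abs_of_pos (e.gaussDensity_pos _)]
    exact e.gaussDensity_le_const _
  · exact (IsElliptic.continuous_gaussDensity _).comp (by fun_prop)

lemma eq_withDensity (h : IsGaussianChain a b δ lamLo lamHi μ) (n : ℕ) :
    μ (n + 1) = volume.withDensity fun y => ENNReal.ofReal (stepDensity a b δ (μ n) y) := by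
  have := h.prob n
  have hm : Measurable fun p : 𝔼 (Fin d) × 𝔼 (Fin d) =>
      gaussDensity (δ • a p.1) (p.2 - p.1 - δ • b p.1) := by
    simpa using h.measurable_density h.zero_add_elliptic
  ext s hs
  rw [withDensity_apply _ hs, ← lintegral_indicator_one hs,
    h.lintegral_succ n _ (measurable_one.indicator hs)]
  simp_rw [lintegral_indicator_one hs, gaussMeasure, withDensity_apply _ hs, ← sub_sub]
  rw [lintegral_lintegral_swap]
  · refine lintegral_congr fun y => ?_
    rw [stepDensity, ofReal_integral_eq_lintegral_ofReal]
    · simpa using h.integrable_density h.zero_add_elliptic n y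
    · exact Filter.Eventually.of_forall fun z =>
        (((h.elliptic z).smul h.step_pos).gaussDensity_pos _).le
  · exact hm.ennreal_ofReal.aemeasurable

/-- Chapman-Kolmogorov against a frozen kernel: convolving it with the transition from `z` adds the
covariances and shifts the mean by the drift. It says that an interpolant of the parametrix can be
read one step earlier. -/
lemma integral_succ (h : IsGaussianChain a b δ lamLo lamHi μ) {M : Matrix (Fin d) (Fin d) ℝ}
    {α β : ℝ} (hM : IsElliptic M α β) (n : ℕ) (y : 𝔼 (Fin d)) :
    ∫ z, gaussDensity M (y - z) ∂(μ (n + 1))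
      = ∫ z, gaussDensity (M + δ • a z) (y - z - δ • b z) ∂(μ n) := by
  have := h.prob n
  have := h.prob (n + 1)
  have hMa : ∀ z, IsElliptic (M + δ • a z) (α + δ * lamLo) (β + δ * lamHi) := fun z =>
    hM.add ((h.elliptic z).smul h.step_pos)
  have hc : Continuous fun z => gaussDensity M (y - z) :=
    (IsElliptic.continuous_gaussDensity M).comp (by fun_prop)
  have e1 := ofReal_integral_eq_lintegral_ofReal (hM.integrable_gaussDensity_sub (μ (n + 1)) y)
    (Filter.Eventually.of_forall fun z => (hM.gaussDensity_pos _).le)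
  have e2 := ofReal_integral_eq_lintegral_ofReal (h.integrable_density hMa n y)
    (Filter.Eventually.of_forall fun z => ((hMa z).gaussDensity_pos _).le)
  rw [h.lintegral_succ n _ hc.measurable.ennreal_ofReal] at e1
  have e3 : ∀ z, ∫⁻ y', ENNReal.ofReal (gaussDensity M (y - y'))
      ∂(gaussMeasure (z + δ • b z) (δ • a z))
      = ENNReal.ofReal (gaussDensity (M + δ • a z) (y - z - δ • b z)) := fun z => by
    have hz := (h.elliptic z).smul h.step_pos
    have := hz.isProbabilityMeasure_gaussMeasure (z + δ • b z)
    rw [← ofReal_integral_eq_lintegral_ofReal (hM.integrable_gaussDensity_sub _ y)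
      (Filter.Eventually.of_forall fun z => (hM.gaussDensity_pos _).le),
      hM.integral_gaussDensity_gaussMeasure hz, sub_sub]
  simp_rw [e3] at e1
  rw [← e2] at e1
  exact (ENNReal.ofReal_eq_ofReal_iff (integral_nonneg fun z => (hM.gaussDensity_pos _).le)
    (integral_nonneg fun z => ((hMa z).gaussDensity_pos _).le)).1 e1

end IsGaussianChain

end

/-! ### Parametrix expansion and the Gaussian bound by induction. -/

section

/-- The isotropic Gaussian density of covariance `4 * lamHi * t`. -/
noncomputable def isoDensity (lamHi t : ℝ) (w : 𝔼 (Fin d)) : ℝ :=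
  gaussDensity ((4 * lamHi * t) • (1 : Matrix (Fin d) (Fin d) ℝ)) w

lemma isElliptic_iso {lamHi t : ℝ} (hhi : 0 < lamHi) (ht : 0 < t) :
    IsElliptic ((4 * lamHi * t) • (1 : Matrix (Fin d) (Fin d) ℝ)) (4 * lamHi * t) (4 * lamHi * t) :=
  IsElliptic.scalar (by positivity)

/-- The right side is the profile produced by `abs_kernel_le`. Being an exact multiple of an
isotropic density, it can be convolved with others of its kind without loss. -/
lemma rpow_mul_isoDensity {lamLo lamHi t : ℝ} (hlo : 0 < lamLo) (hhi : 0 < lamHi) (ht : 0 < t)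
    (w : 𝔼 (Fin d)) :
    (4 * lamHi / lamLo) ^ ((d : ℝ) / 2) * isoDensity lamHi t w
      = Real.exp (-(‖w‖ ^ 2 / (8 * lamHi * t))) / (2 * Real.pi * (lamLo * t)) ^ ((d : ℝ) / 2) := by
  rw [isoDensity, gaussDensity_scalar (by positivity)]
  have e1 : 2 * (4 * lamHi * t) = 8 * lamHi * t := by ring
  have e2 : 2 * Real.pi * (4 * lamHi * t) = (4 * lamHi / lamLo) * (2 * Real.pi * (lamLo * t)) := by
    field_simp
  have h1 : 0 < (4 * lamHi / lamLo) ^ ((d : ℝ) / 2) := by positivity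
  have h2 : 0 < (2 * Real.pi * (lamLo * t)) ^ ((d : ℝ) / 2) := by positivity
  rw [e1, e2, Real.mul_rpow (by positivity) (by positivity)]
  field_simp

lemma integral_isoDensity_gaussMeasure {lamHi s t : ℝ} (hhi : 0 < lamHi) (hs : 0 < s) (ht : 0 < t)
    (x y : 𝔼 (Fin d)) :
    ∫ z, isoDensity lamHi s (y - z)
      ∂(gaussMeasure x ((4 * lamHi * t) • (1 : Matrix (Fin d) (Fin d) ℝ)))
      = isoDensity lamHi (s + t) (y - x) := by
  simp_rw [isoDensity]
  rw [(isElliptic_iso hhi hs).integral_gaussDensity_gaussMeasure (isElliptic_iso hhi ht),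
    ← add_smul, mul_add]

/-- The coefficients of a uniformly elliptic diffusion whose covariance is controlled by the
Lipschitz constant `L₀`, with drift bounded by `B`. -/
structure CoeffBounds (a : 𝔼 (Fin d) → Matrix (Fin d) (Fin d) ℝ) (b : 𝔼 (Fin d) → 𝔼 (Fin d))
    (lamLo lamHi L₀ B : ℝ) : Prop where
  dim_pos : 0 < d
  le : lamLo ≤ lamHi
  nonneg : 0 ≤ L₀
  covariance : ∀ z y ξ : 𝔼 (Fin d),
    |qf (a z) ξ - qf (a y) ξ| ≤ 2 * Real.sqrt lamHi * L₀ * ‖y - z‖ * ‖ξ‖ ^ 2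
  drift : ∀ z, ‖b z‖ ≤ B

namespace IsGaussianChain

variable {a : 𝔼 (Fin d) → Matrix (Fin d) (Fin d) ℝ} {b : 𝔼 (Fin d) → 𝔼 (Fin d)}
  {δ lamLo lamHi L₀ B T : ℝ} {μ : ℕ → Measure (𝔼 (Fin d))}

/-- One term of the telescoping sum of the parametrix expansion. -/
lemma integral_kernel_le (h : IsGaussianChain a b δ lamLo lamHi μ)
    (hc : CoeffBounds a b lamLo lamHi L₀ B) (hδT : δ ≤ T) (i r : ℕ) (y : 𝔼 (Fin d)) :
    ∫ z, gaussDensity (((r : ℝ) * δ) • a y + δ • a z) (y - z - δ • b z) ∂(μ i)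
        - ∫ z, gaussDensity ((((r : ℝ) + 1) * δ) • a y) (y - z) ∂(μ i)
      ≤ δ / Real.sqrt (((r : ℝ) + 1) * δ) * (kernelConst d B lamLo lamHi L₀ T
          * (4 * lamHi / lamLo) ^ ((d : ℝ) / 2))
        * ∫ z, isoDensity lamHi (((r : ℝ) + 1) * δ) (y - z) ∂(μ i) := by
  have := h.prob i
  have hlo := (h.elliptic y).pos
  have hhi := (h.elliptic y).pos'
  have hδ := h.step_pos
  set t := ((r : ℝ) + 1) * δ with ht
  have ht0 : 0 < t := by positivity
  have i1 := h.integrable_density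
    (fun z => (h.elliptic y).mul_smul_add_smul (h.elliptic z) r hδ) i y
  have i2 := ((h.elliptic y).smul ht0).integrable_gaussDensity_sub (μ i) y
  have i3 := (isElliptic_iso (d := d) hhi ht0).integrable_gaussDensity_sub (μ i) y
  rw [← integral_sub i1 i2, ← integral_const_mul]
  refine integral_mono (i1.sub i2) (i3.const_mul _) fun z => ?_
  have h1 := abs_kernel_le hc.dim_pos (h.elliptic y) (h.elliptic z) hc.le hc.nonneg (y - z) (b z)
    (fun ξ => hc.covariance z y ξ) (hc.drift z) r hδ hδT ht
  refine (le_abs_self _).trans (h1.trans_eq ?_)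
  rw [← rpow_mul_isoDensity hlo hhi ht0]
  ring

/-- The parametrix expansion of the density as a telescoping sum. -/
lemma stepDensity_eq_sum (h : IsGaussianChain a b δ lamLo lamHi μ) (n : ℕ) (y : 𝔼 (Fin d)) :
    stepDensity a b δ (μ n) y = ∫ z, gaussDensity ((((n : ℝ) + 1) * δ) • a y) (y - z) ∂(μ 0) +
      ∑ i ∈ Finset.range (n + 1),
        (∫ z, gaussDensity ((((n - i : ℕ) : ℝ) * δ) • a y + δ • a z) (y - z - δ • b z) ∂(μ i)
        - ∫ z, gaussDensity (((((n - i : ℕ) : ℝ) + 1) * δ) • a y) (y - z) ∂(μ i)) := by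
  set F : ℕ → ℝ := fun i =>
    ∫ z, gaussDensity (((((n - i : ℕ) : ℝ) + 1) * δ) • a y) (y - z) ∂(μ i) with hF
  set I : ℕ → ℝ := fun i =>
    ∫ z, gaussDensity ((((n - i : ℕ) : ℝ) * δ) • a y + δ • a z) (y - z - δ • b z) ∂(μ i) with hI
  have hδ := h.step_pos
  -- `F i` takes `i` true steps and then only frozen ones; `I i` takes one more true step, so it is
  -- `F (i + 1)`.
  have h1 : ∀ i ∈ Finset.range n, I i - F i = F (i + 1) - F i := fun i hi => by
    have hi' := Finset.mem_range.1 hi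
    have e : ((n - i : ℕ) : ℝ) = ((n - (i + 1) : ℕ) : ℝ) + 1 := by
      have : n - i = n - (i + 1) + 1 := by omega
      rw [this]; push_cast; rfl
    simp only [hI, hF]
    rw [h.integral_succ ((h.elliptic y).smul (by positivity)) i y, e]
  -- For `i = n` no frozen step is left, so `I n` is the true density rather than a value of `F`.
  have h2 : I n = stepDensity a b δ (μ n) y := by
    simp [hI, stepDensity]
  have h3 : F 0 = ∫ z, gaussDensity ((((n : ℝ) + 1) * δ) • a y) (y - z) ∂(μ 0) := by
    simp [hF]
  change _ = _ + ∑ i ∈ Finset.range (n + 1), (I i - F i)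
  rw [Finset.sum_range_succ, Finset.sum_congr rfl h1, Finset.sum_range_sub, h2, ← h3]
  ring

/-- The Gaussian bound of the density after `n + 1` steps, given Gaussian bounds of the laws up to
step `n`. -/
lemma stepDensity_le_of_integral_le (h : IsGaussianChain a b δ lamLo lamHi μ)
    (hc : CoeffBounds a b lamLo lamHi L₀ B) (hδT : δ ≤ T) {x : 𝔼 (Fin d)}
    (h0 : μ 0 = Measure.dirac x) {Q c : ℝ} (hQ : Q = (4 * lamHi / lamLo) ^ ((d : ℝ) / 2))
    (hcQ : c = kernelConst d B lamLo lamHi L₀ T * Q) (n : ℕ)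
    (hn : ∀ i ≤ n, ∀ s, 0 < s → ∀ y, ∫ z, isoDensity lamHi s (y - z) ∂(μ i)
      ≤ Q * mittagLeffler (Real.sqrt Real.pi * c * Real.sqrt (i * δ))
        * isoDensity lamHi (s + i * δ) (y - x)) (y : 𝔼 (Fin d)) :
    stepDensity a b δ (μ n) y
      ≤ Q * mittagLeffler (Real.sqrt Real.pi * c * Real.sqrt ((n + 1 : ℕ) * δ))
        * isoDensity lamHi ((n + 1 : ℕ) * δ) (y - x) := by
  have hlo := (h.elliptic y).pos
  have hhi := (h.elliptic y).pos'
  have hδ := h.step_pos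
  have hQ0 : 0 < Q := by rw [hQ]; positivity
  have hL := hc.nonneg
  have hB : 0 ≤ B := (norm_nonneg _).trans (hc.drift x)
  have hc0 : 0 ≤ c := by
    rw [hcQ, kernelConst]; positivity
  set t := ((n + 1 : ℕ) : ℝ) * δ with ht
  have ht0 : 0 < t := by positivity
  set g := isoDensity lamHi t (y - x) with hg
  have hg0 : 0 < g := (isElliptic_iso hhi ht0).gaussDensity_pos _
  -- The Dirac start leaves a single frozen Gaussian, which is widened to the common profile.
  have hfirst : ∫ z, gaussDensity ((((n : ℝ) + 1) * δ) • a y) (y - z) ∂(μ 0) ≤ Q * g := by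
    have e : ((n : ℝ) + 1) * δ = t := by rw [ht]; push_cast; ring
    rw [h0, integral_dirac, e, hQ, hg, rpow_mul_isoDensity hlo hhi ht0]
    refine (((h.elliptic y).smul ht0).gaussDensity_le (y - x)).trans ?_
    rw [mul_comm t lamLo]
    gcongr ?_ / _
    rw [Real.exp_le_exp, neg_le_neg_iff]
    have : 2 * (t * lamHi) ≤ 8 * lamHi * t := by nlinarith [mul_pos ht0 hhi]
    gcongr
  have hterm : ∀ i ∈ Finset.range (n + 1),
      (∫ z, gaussDensity ((((n - i : ℕ) : ℝ) * δ) • a y + δ • a z) (y - z - δ • b z) ∂(μ i)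
        - ∫ z, gaussDensity (((((n - i : ℕ) : ℝ) + 1) * δ) • a y) (y - z) ∂(μ i))
      ≤ Q * g * (δ / Real.sqrt ((((n + 1 : ℕ) : ℝ) - i) * δ) * c *
        mittagLeffler (Real.sqrt Real.pi * c * Real.sqrt (i * δ))) := fun i hi => by
    have hi' : i ≤ n := Nat.lt_succ_iff.1 (Finset.mem_range.1 hi)
    have e : ((n - i : ℕ) : ℝ) + 1 = ((n + 1 : ℕ) : ℝ) - i := by
      rw [Nat.cast_sub hi']; push_cast; ring
    refine (h.integral_kernel_le hc hδT i (n - i) y).trans ?_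
    have hs : 0 < (((n - i : ℕ) : ℝ) + 1) * δ := by positivity
    have h2 := hn i hi' _ hs y
    -- Time left plus elapsed time is `t` for every `i`. Hence the Gaussian `g` factors out of the
    -- whole sum and only scalars remain.
    have e2 : (((n - i : ℕ) : ℝ) + 1) * δ + i * δ = t := by rw [e, ht]; ring
    rw [e2, ← hg] at h2
    rw [← hQ, ← hcQ, e] at *
    calc _ ≤ δ / Real.sqrt ((((n + 1 : ℕ) : ℝ) - i) * δ) * c *
          (Q * mittagLeffler (Real.sqrt Real.pi * c * Real.sqrt (i * δ)) * g) := by gcongr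
      _ = _ := by ring
  rw [h.stepDensity_eq_sum n y]
  calc _ ≤ Q * g + ∑ i ∈ Finset.range (n + 1),
        Q * g * (δ / Real.sqrt ((((n + 1 : ℕ) : ℝ) - i) * δ) * c *
        mittagLeffler (Real.sqrt Real.pi * c * Real.sqrt (i * δ))) :=
        add_le_add hfirst (Finset.sum_le_sum hterm)
    _ = Q * g * (1 + ∑ i ∈ Finset.range (n + 1),
        (δ / Real.sqrt ((((n + 1 : ℕ) : ℝ) - i) * δ) * c *
        mittagLeffler (Real.sqrt Real.pi * c * Real.sqrt (i * δ)))) := by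
        rw [← Finset.mul_sum]; ring
    _ ≤ Q * g * mittagLeffler (Real.sqrt Real.pi * c * Real.sqrt ((n + 1 : ℕ) * δ)) := by
        gcongr
        exact one_add_sum_mittagLeffler_le hc0 hδ (n + 1)
    _ = _ := by ring

/-- A pointwise bound of the density is a domination of the law by `C` times a Gaussian measure, and
isotropic Gaussians convolve by adding their times. This feeds a density bound back into the
induction. -/
lemma integral_isoDensity_succ_le (h : IsGaussianChain a b δ lamLo lamHi μ) {x : 𝔼 (Fin d)}
    {C : ℝ} (hC : 0 ≤ C) (n : ℕ)
    (hn : ∀ y, stepDensity a b δ (μ n) y ≤ C * isoDensity lamHi ((n + 1 : ℕ) * δ) (y - x))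
    {s : ℝ} (hs : 0 < s) (y : 𝔼 (Fin d)) :
    ∫ z, isoDensity lamHi s (y - z) ∂(μ (n + 1))
      ≤ C * isoDensity lamHi (s + (n + 1 : ℕ) * δ) (y - x) := by
  have hhi := (h.elliptic y).pos'
  have hδ := h.step_pos
  have ht0 : 0 < ((n + 1 : ℕ) : ℝ) * δ := by positivity
  set γ := gaussMeasure x ((4 * lamHi * (((n + 1 : ℕ) : ℝ) * δ)) • (1 : Matrix (Fin d) (Fin d) ℝ))
    with hγ
  have hp : IsProbabilityMeasure γ :=
    (isElliptic_iso hhi ht0).isProbabilityMeasure_gaussMeasure x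
  have hle : μ (n + 1) ≤ ENNReal.ofReal C • γ := by
    rw [h.eq_withDensity n, hγ, gaussMeasure, ← withDensity_smul _ (by
      have := IsElliptic.continuous_gaussDensity
        ((4 * lamHi * (((n + 1 : ℕ) : ℝ) * δ)) • (1 : Matrix (Fin d) (Fin d) ℝ))
      fun_prop)]
    refine withDensity_mono (Filter.Eventually.of_forall fun z => ?_)
    rw [Pi.smul_apply, smul_eq_mul, ← ENNReal.ofReal_mul hC]
    exact ENNReal.ofReal_le_ofReal (hn z)
  have hi := (isElliptic_iso (d := d) hhi hs).integrable_gaussDensity_sub γ y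
  have h1 := integral_mono_measure hle (Filter.Eventually.of_forall fun z =>
    ((isElliptic_iso (d := d) hhi hs).gaussDensity_pos (y - z)).le)
    (hi.smul_measure ENNReal.ofReal_ne_top)
  rw [integral_smul_measure, ENNReal.toReal_ofReal hC, smul_eq_mul] at h1
  rw [← integral_isoDensity_gaussMeasure hhi hs ht0]
  exact h1

/-- The Gaussian bound of the laws of the chain. -/
theorem integral_isoDensity_le (h : IsGaussianChain a b δ lamLo lamHi μ)
    (hc : CoeffBounds a b lamLo lamHi L₀ B) (hδT : δ ≤ T) {x : 𝔼 (Fin d)}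
    (h0 : μ 0 = Measure.dirac x) {Q c : ℝ} (hQ : Q = (4 * lamHi / lamLo) ^ ((d : ℝ) / 2))
    (hcQ : c = kernelConst d B lamLo lamHi L₀ T * Q) (n : ℕ) :
    ∀ s, 0 < s → ∀ y, ∫ z, isoDensity lamHi s (y - z) ∂(μ n)
      ≤ Q * mittagLeffler (Real.sqrt Real.pi * c * Real.sqrt (n * δ))
        * isoDensity lamHi (s + n * δ) (y - x) := by
  have hlo := (h.elliptic x).pos
  have hhi := (h.elliptic x).pos'
  have hL := hc.nonneg
  have hB : 0 ≤ B := (norm_nonneg _).trans (hc.drift x)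
  have hQ0 : 0 < Q := by rw [hQ]; positivity
  have hc0 : 0 ≤ c := by
    rw [hcQ, kernelConst]; positivity
  -- Strong induction, since the expansion involves the laws at all earlier steps. At step 0 the law
  -- is a Dirac mass and the claim is `1 ≤ Q`.
  induction n using Nat.strong_induction_on with
  | _ n ih =>
    intro s hs y
    cases n with
    | zero =>
      have h1 : 1 ≤ Q := by
        rw [hQ]
        refine Real.one_le_rpow ?_ (by positivity)
        rw [one_le_div hlo]
        linarith [hc.le]
      have h2 : 0 < isoDensity lamHi s (y - x) := (isElliptic_iso hhi hs).gaussDensity_pos _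
      rw [h0, integral_dirac]
      simp only [Nat.cast_zero, zero_mul, Real.sqrt_zero, mul_zero, add_zero, mittagLeffler_zero,
        mul_one]
      exact le_mul_of_one_le_left h2.le h1
    | succ n =>
      refine h.integral_isoDensity_succ_le ?_ n
        (h.stepDensity_le_of_integral_le hc hδT h0 hQ hcQ n fun i hi => ih i (by omega)) hs y
      exact mul_nonneg hQ0.le (mittagLeffler_nonneg (by positivity))

/-- The Gaussian bound of the densities of the chain. -/
theorem stepDensity_le (h : IsGaussianChain a b δ lamLo lamHi μ)
    (hc : CoeffBounds a b lamLo lamHi L₀ B) (hδT : δ ≤ T) {x : 𝔼 (Fin d)}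
    (h0 : μ 0 = Measure.dirac x) {Q c : ℝ} (hQ : Q = (4 * lamHi / lamLo) ^ ((d : ℝ) / 2))
    (hcQ : c = kernelConst d B lamLo lamHi L₀ T * Q) (n : ℕ) (y : 𝔼 (Fin d)) :
    stepDensity a b δ (μ n) y
      ≤ Q * mittagLeffler (Real.sqrt Real.pi * c * Real.sqrt ((n + 1 : ℕ) * δ))
        * isoDensity lamHi ((n + 1 : ℕ) * δ) (y - x) :=
  h.stepDensity_le_of_integral_le hc hδT h0 hQ hcQ n
    (fun i _ => h.integral_isoDensity_le hc hδT h0 hQ hcQ i) y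

end IsGaussianChain

end

/-! ### The Euler-Maruyama scheme as a Gaussian chain. -/

section

variable {Ω : Type*}

/-- The covariance matrix of the noise. -/
def covMatrix (σ : 𝔼 (Fin d) → Matrix (Fin d) (Fin m) ℝ) (z : 𝔼 (Fin d)) :
    Matrix (Fin d) (Fin d) ℝ :=
  σ z * (σ z).transpose

section Coefficients

variable {σ : 𝔼 (Fin d) → Matrix (Fin d) (Fin m) ℝ} {lamLo lamHi L₀ : ℝ}

lemma EllipticLipschitz.isElliptic (hσ : EllipticLipschitz σ lamLo lamHi L₀) (z : 𝔼 (Fin d)) :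
    IsElliptic (covMatrix σ z) lamLo lamHi where
  pos := hσ.lamLo_pos
  pos' := hσ.lamHi_pos
  symm := by rw [covMatrix, Matrix.transpose_mul, Matrix.transpose_transpose]
  lower w := hσ.lower z w
  upper w := hσ.upper z w

lemma EllipticLipschitz.le (hσ : EllipticLipschitz σ lamLo lamHi L₀) (hd : 0 < d) :
    lamLo ≤ lamHi := by
  have h := (hσ.lower 0 (EuclideanSpace.single ⟨0, hd⟩ 1)).trans
    (hσ.upper 0 (EuclideanSpace.single ⟨0, hd⟩ 1))
  simpa using h

lemma abs_apply_le_hsNorm (A : Matrix (Fin d) (Fin m) ℝ) (i : Fin d) (k : Fin m) :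
    |A i k| ≤ hsNorm A := by
  rw [hsNorm]
  refine Real.abs_le_sqrt ?_
  calc A i k ^ 2 ≤ ∑ k, A i k ^ 2 :=
        Finset.single_le_sum (f := fun k => A i k ^ 2) (fun _ _ => sq_nonneg _) (Finset.mem_univ k)
    _ ≤ _ := Finset.single_le_sum (f := fun i => ∑ k, A i k ^ 2)
        (fun _ _ => Finset.sum_nonneg fun _ _ => sq_nonneg _) (Finset.mem_univ i)

lemma EllipticLipschitz.continuous_apply (hσ : EllipticLipschitz σ lamLo lamHi L₀) (i : Fin d)
    (k : Fin m) : Continuous fun z => σ z i k := by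
  have : LipschitzWith (Real.toNNReal L₀) fun z => σ z i k :=
    LipschitzWith.of_dist_le_mul fun z y => by
      rw [Real.dist_eq, dist_eq_norm, Real.coe_toNNReal _ hσ.L₀_pos.le]
      exact (abs_apply_le_hsNorm (σ z - σ y) i k).trans (hσ.lipschitz z y)
  exact this.continuous

lemma act_apply (A : Matrix (Fin d) (Fin m) ℝ) (u : 𝔼 (Fin m)) (i : Fin d) :
    act A u i = ∑ k, A i k * u k := by
  simp [act, Matrix.mulVec, dotProduct]

lemma norm_act_le (A : Matrix (Fin d) (Fin m) ℝ) (u : 𝔼 (Fin m)) :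
    ‖act A u‖ ≤ hsNorm A * ‖u‖ := by
  rw [EuclideanSpace.norm_eq, EuclideanSpace.norm_eq, hsNorm, ← Real.sqrt_mul (by positivity)]
  refine Real.sqrt_le_sqrt ?_
  rw [Finset.sum_mul]
  refine Finset.sum_le_sum fun i _ => ?_
  simp only [Real.norm_eq_abs, sq_abs, act_apply]
  exact Finset.sum_mul_sq_le_sq_mul_sq _ _ _

lemma hsNorm_transpose (A : Matrix (Fin d) (Fin m) ℝ) : hsNorm A.transpose = hsNorm A := by
  simp only [hsNorm, Matrix.transpose_apply]
  rw [Finset.sum_comm]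

lemma EllipticLipschitz.norm_act_transpose_le (hσ : EllipticLipschitz σ lamLo lamHi L₀)
    (z ξ : 𝔼 (Fin d)) : ‖act (σ z).transpose ξ‖ ≤ Real.sqrt lamHi * ‖ξ‖ := by
  have h := (hσ.isElliptic z).upper ξ
  rw [covMatrix, qf_mul_transpose] at h
  refine abs_le_of_sq_le_sq' ?_ (by positivity) |>.2
  rwa [mul_pow, Real.sq_sqrt hσ.lamHi_pos.le]

/-- The form of σσ* is the squared norm of σ*ξ. Factoring the difference of squares, one factor is
Lipschitz and the other is at most `2 √lamHi ‖ξ‖`. -/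
lemma EllipticLipschitz.coeffBounds (hσ : EllipticLipschitz σ lamLo lamHi L₀) (hd : 0 < d)
    {b : 𝔼 (Fin d) → 𝔼 (Fin d)} (hb : BddAbove (Set.range fun x => ‖b x‖)) :
    CoeffBounds (covMatrix σ) b lamLo lamHi L₀ (supNorm b) where
  dim_pos := hd
  le := hσ.le hd
  nonneg := hσ.L₀_pos.le
  drift z := le_ciSup hb z
  covariance z y ξ := by
    rw [covMatrix, covMatrix, qf_mul_transpose, qf_mul_transpose]
    set u := act (σ z).transpose ξ
    set v := act (σ y).transpose ξ
    have h1 : ‖u - v‖ ≤ L₀ * ‖y - z‖ * ‖ξ‖ := by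
      have e : u - v = act (σ z - σ y).transpose ξ := by
        simp [u, v, act, Matrix.transpose_sub]
      rw [e]
      refine (norm_act_le _ _).trans ?_
      rw [hsNorm_transpose, norm_sub_rev y z]
      gcongr
      exact hσ.lipschitz z y
    have h2 := abs_norm_sub_norm_le u v
    have hu := hσ.norm_act_transpose_le z ξ
    have hv := hσ.norm_act_transpose_le y ξ
    have e : ‖u‖ ^ 2 - ‖v‖ ^ 2 = (‖u‖ - ‖v‖) * (‖u‖ + ‖v‖) := by ring
    have hL := hσ.L₀_pos
    rw [e, abs_mul, abs_of_nonneg (by positivity : 0 ≤ ‖u‖ + ‖v‖)]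
    calc _ ≤ (L₀ * ‖y - z‖ * ‖ξ‖) * (Real.sqrt lamHi * ‖ξ‖ + Real.sqrt lamHi * ‖ξ‖) := by
          gcongr
          exact h2.trans h1
      _ = _ := by ring

lemma EllipticLipschitz.measurable_qf (hσ : EllipticLipschitz σ lamLo lamHi L₀) :
    Measurable fun p : 𝔼 (Fin d) × 𝔼 (Fin d) => qf (covMatrix σ p.1) p.2 := by
  have hc := hσ.continuous_apply
  have h : Continuous fun p : 𝔼 (Fin d) × 𝔼 (Fin d) => qf (covMatrix σ p.1) p.2 := by
    simp_rw [covMatrix, qf_mul_transpose, EuclideanSpace.norm_sq_eq, act_apply,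
      Matrix.transpose_apply]
    refine continuous_finsetSum _ fun k _ => Continuous.pow (Continuous.norm
      (continuous_finsetSum _ fun i _ => ?_)) 2
    have := hc i k
    fun_prop
  exact h.measurable

end Coefficients

/-- One step of the Euler-Maruyama scheme. -/
noncomputable def stepMap (b : 𝔼 (Fin d) → 𝔼 (Fin d)) (σ : 𝔼 (Fin d) → Matrix (Fin d) (Fin m) ℝ)
    (δ : ℝ) (p : 𝔼 (Fin d) × 𝔼 (Fin m)) : 𝔼 (Fin d) :=
  p.1 + δ • b p.1 + act (σ p.1) p.2

lemma measurable_stepMap {σ : 𝔼 (Fin d) → Matrix (Fin d) (Fin m) ℝ} {lamLo lamHi L₀ : ℝ}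
    (hσ : EllipticLipschitz σ lamLo lamHi L₀) {b : 𝔼 (Fin d) → 𝔼 (Fin d)} (hb : Measurable b)
    (δ : ℝ) : Measurable (stepMap b σ δ) := by
  have h1 : Measurable fun p : 𝔼 (Fin d) × 𝔼 (Fin m) => act (σ p.1) p.2 := by
    have h2 : Continuous fun p : 𝔼 (Fin d) × 𝔼 (Fin m) => act (σ p.1) p.2 := by
      refine (PiLp.continuous_toLp 2 _).comp (f := fun p : 𝔼 (Fin d) × 𝔼 (Fin m) =>
        (σ p.1).mulVec p.2.ofLp) (continuous_pi fun i => ?_)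
      simp only [Matrix.mulVec, dotProduct]
      refine continuous_finsetSum _ fun k _ => ?_
      have := hσ.continuous_apply i k
      fun_prop
    exact h2.measurable
  unfold stepMap
  fun_prop

/-- The increments of the driving path over the time grid. -/
def gridIncrement (W : ℝ≥0 → Ω → 𝔼 (Fin m)) (δ : ℝ) (j k : ℕ) (ω : Ω) : 𝔼 (Fin m) :=
  W (Real.toNNReal (((j + k + 1 : ℕ) : ℝ) * δ)) ω - W (Real.toNNReal (((j + k : ℕ) : ℝ) * δ)) ω

lemma emChain_succ (b : 𝔼 (Fin d) → 𝔼 (Fin d)) (σ : 𝔼 (Fin d) → Matrix (Fin d) (Fin m) ℝ)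
    (δ : ℝ) (W : ℝ≥0 → Ω → 𝔼 (Fin m)) (j : ℕ) (x : 𝔼 (Fin d)) (n : ℕ) (ω : Ω) :
    emChain b σ δ W j x (n + 1) ω
      = stepMap b σ δ (emChain b σ δ W j x n ω, gridIncrement W δ j n ω) := rfl

/-- Displays the chain as a measurable function of the scalar increments before step `n`. The index
pairs a coordinate with a step because independence is available for that scalar family. -/
lemma exists_emChain_eq {b : 𝔼 (Fin d) → 𝔼 (Fin d)}
    {σ : 𝔼 (Fin d) → Matrix (Fin d) (Fin m) ℝ} {lamLo lamHi L₀ : ℝ}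
    (hσ : EllipticLipschitz σ lamLo lamHi L₀) (hb : Measurable b)
    (δ : ℝ) (W : ℝ≥0 → Ω → 𝔼 (Fin m)) (j : ℕ) (x : 𝔼 (Fin d)) (n : ℕ) :
    ∃ G : ((Finset.univ ×ˢ Finset.range n : Finset (Fin m × ℕ)) → ℝ) → 𝔼 (Fin d), Measurable G ∧
      ∀ ω, emChain b σ δ W j x n ω = G fun p => gridIncrement W δ j p.1.2 ω p.1.1 := by
  induction n with
  | zero => exact ⟨fun _ => x, measurable_const, fun _ => rfl⟩
  | succ n ih =>
    obtain ⟨G, hG, e⟩ := ih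
    refine ⟨fun v => stepMap b σ δ
      (G fun p => v ⟨p.1, by
        have := p.2; simp only [Finset.mem_product, Finset.mem_univ, Finset.mem_range, true_and] at this ⊢
        omega⟩, WithLp.toLp 2 fun i => v ⟨(i, n), by simp⟩), ?_, fun ω => ?_⟩
    · refine (measurable_stepMap hσ hb δ).comp (Measurable.prodMk (hG.comp ?_) ?_)
      · fun_prop
      · fun_prop
    · rw [emChain_succ, e]

variable [MeasurableSpace Ω] {P : Measure Ω}

namespace IsBrownianMotion

variable {W : ℝ≥0 → Ω → 𝔼 (Fin m)}

lemma measurable_gridIncrement (hW : IsBrownianMotion W P) (δ : ℝ) (j k : ℕ) :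
    Measurable (gridIncrement W δ j k) :=
  (hW.measurable _).sub (hW.measurable _)

/-- Independence over coordinates comes from `indep`, independence over steps from the independent
increments of each coordinate; together they give joint independence over pairs. -/
lemma iIndepFun_gridIncrement (hW : IsBrownianMotion W P) {δ : ℝ} (hδ : 0 < δ) (j : ℕ) :
    iIndepFun (fun (p : Fin m × ℕ) ω => gridIncrement W δ j p.2 ω p.1) P := by
  refine iIndepFun_uncurry' (X := fun (i : Fin m) (k : ℕ) ω => gridIncrement W δ j k ω i)
    (fun i k => ?_) ?_ fun i => ?_
  · have := hW.measurable_gridIncrement δ j k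
    fun_prop
  · exact hW.indep.comp (fun _ (f : ℝ≥0 → ℝ) (k : ℕ) =>
      f (Real.toNNReal (((j + k + 1 : ℕ) : ℝ) * δ)) - f (Real.toNNReal (((j + k : ℕ) : ℝ) * δ)))
      (fun _ => by fun_prop)
  · have hmono : Monotone fun k : ℕ => Real.toNNReal (((j + k : ℕ) : ℝ) * δ) := fun k l hkl => by
      refine Real.toNNReal_le_toNNReal ?_
      gcongr
    exact (hW.coord i).toIsPreBrownianReal.hasIndepIncrements.nat hmono

variable [IsProbabilityMeasure P]

lemma charFun_gridIncrement (hW : IsBrownianMotion W P) {δ : ℝ} (hδ : 0 < δ) (j k : ℕ)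
    (η : 𝔼 (Fin m)) :
    charFun (P.map (gridIncrement W δ j k)) η = Complex.exp (-(δ * ‖η‖ ^ 2 / 2 : ℝ)) := by
  have hmeas : ∀ i, Measurable fun ω => gridIncrement W δ j k ω i := fun i => by
    have := hW.measurable_gridIncrement δ j k
    fun_prop
  have hind : iIndepFun (fun (i : Fin m) ω => gridIncrement W δ j k ω i) P :=
    (hW.iIndepFun_gridIncrement hδ j).precomp (g := fun i => (i, k)) fun i i' h => by
      simpa using h
  have h := (iIndepFun_iff_charFun_pi fun i => (hmeas i).aemeasurable).1 hind η
  have hlaw : ∀ i, P.map (fun ω => gridIncrement W δ j k ω i) = gaussianReal 0 (Real.toNNReal δ) :=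
    fun i => by
      have h1 := ((hW.coord i).toIsPreBrownianReal.hasLaw_sub
        (Real.toNNReal (((j + k + 1 : ℕ) : ℝ) * δ)) (Real.toNNReal (((j + k : ℕ) : ℝ) * δ))).map_eq
      have e : nndist (Real.toNNReal (((j + k + 1 : ℕ) : ℝ) * δ)).1
          (Real.toNNReal (((j + k : ℕ) : ℝ) * δ)).1 = Real.toNNReal δ := by
        ext
        rw [coe_nndist, Real.dist_eq, NNReal.val_eq_coe, NNReal.val_eq_coe,
          Real.coe_toNNReal _ hδ.le, Real.coe_toNNReal _ (by positivity),
          Real.coe_toNNReal _ (by positivity)]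
        push_cast
        rw [← sub_mul, add_sub_cancel_left, one_mul, abs_of_pos hδ]
      rw [e] at h1
      exact h1
  simp_rw [hlaw, charFun_gaussianReal, Real.coe_toNNReal _ hδ.le] at h
  refine h.trans ?_
  rw [← Complex.exp_sum, EuclideanSpace.norm_sq_eq]
  congr 1
  push_cast
  simp only [mul_zero, zero_mul, zero_sub, Real.norm_eq_abs, Finset.mul_sum, Finset.sum_div,
    ← Finset.sum_neg_distrib]
  refine Finset.sum_congr rfl fun i _ => ?_
  rw [← Complex.ofReal_pow, ← Complex.ofReal_pow, sq_abs]

end IsBrownianMotion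

section Chain

variable {W : ℝ≥0 → Ω → 𝔼 (Fin m)}
  {b : 𝔼 (Fin d) → 𝔼 (Fin d)} {σ : 𝔼 (Fin d) → Matrix (Fin d) (Fin m) ℝ}
  {lamLo lamHi L₀ δ : ℝ}

lemma measurable_emChain (hW : IsBrownianMotion W P) (hσ : EllipticLipschitz σ lamLo lamHi L₀)
    (hb : Measurable b) (j : ℕ) (x : 𝔼 (Fin d)) (n : ℕ) :
    Measurable (emChain b σ δ W j x n) := by
  induction n with
  | zero => exact measurable_const
  | succ n ih =>
    exact (measurable_stepMap hσ hb δ).comp (ih.prodMk (hW.measurable_gridIncrement δ j n))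

lemma indepFun_emChain (hW : IsBrownianMotion W P) (hσ : EllipticLipschitz σ lamLo lamHi L₀)
    (hb : Measurable b) (hδ : 0 < δ) (j : ℕ) (x : 𝔼 (Fin d)) (n : ℕ) :
    IndepFun (emChain b σ δ W j x n) (gridIncrement W δ j n) P := by
  obtain ⟨G, hG, e⟩ := exists_emChain_eq hσ hb δ W j x n
  have hdisj : Disjoint (Finset.univ ×ˢ Finset.range n : Finset (Fin m × ℕ))
      (Finset.univ ×ˢ {n}) := by
    rw [Finset.disjoint_product]
    right
    simp
  have h := (hW.iIndepFun_gridIncrement hδ j).indepFun_finset _ _ hdisj fun p => by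
    have := hW.measurable_gridIncrement δ j p.2
    fun_prop
  have hH : Measurable fun v : ((Finset.univ ×ˢ {n} : Finset (Fin m × ℕ)) → ℝ) =>
      (WithLp.toLp 2 fun i => v ⟨(i, n), by simp⟩ : 𝔼 (Fin m)) := by fun_prop
  have h2 := h.comp hG hH
  convert h2 using 1
  · exact funext e
  · rfl

variable [IsProbabilityMeasure P]

/-- Characteristic functions agree: the noise contributes `‖σ*ξ‖²`, the form of σσ* at ξ. This works
for rectangular `σ`. -/
lemma map_stepMap (hW : IsBrownianMotion W P) (hσ : EllipticLipschitz σ lamLo lamHi L₀)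
    (hb : Measurable b) (hδ : 0 < δ) (j k : ℕ) (z : 𝔼 (Fin d)) :
    (P.map (gridIncrement W δ j k)).map (fun u => stepMap b σ δ (z, u))
      = gaussMeasure (z + δ • b z) (δ • covMatrix σ z) := by
  have hE := (hσ.isElliptic z).smul hδ
  have := hE.isProbabilityMeasure_gaussMeasure (z + δ • b z)
  have hs : Measurable fun u : 𝔼 (Fin m) => stepMap b σ δ (z, u) :=
    (measurable_stepMap hσ hb δ).comp (by fun_prop)
  have := Measure.isProbabilityMeasure_map (μ := P)
    (hW.measurable_gridIncrement δ j k).aemeasurable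
  have := Measure.isProbabilityMeasure_map (μ := P.map (gridIncrement W δ j k)) hs.aemeasurable
  refine Measure.ext_of_charFun (funext fun ξ => ?_)
  rw [hE.charFun_gaussMeasure, charFun_apply, integral_map hs.aemeasurable (by fun_prop)]
  have e : ∀ u : 𝔼 (Fin m), Complex.exp ((inner ℝ (stepMap b σ δ (z, u)) ξ : ℝ) * Complex.I)
      = Complex.exp (Complex.I * (inner ℝ (z + δ • b z) ξ : ℝ))
        * Complex.exp ((inner ℝ u (act (σ z).transpose ξ) : ℝ) * Complex.I) := fun u => by
    rw [← Complex.exp_add, stepMap, inner_add_left _ (act (σ z) u), inner_act_left]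
    congr 1
    push_cast
    ring
  simp_rw [e]
  rw [integral_const_mul, ← charFun_apply, hW.charFun_gridIncrement hδ, ← Complex.exp_add,
    qf_smul, covMatrix, qf_mul_transpose, add_comm]

/-- The current position depends only on earlier increments, hence is independent of the next one;
the joint law is a product, and Tonelli splits off the Gaussian step. -/
theorem isGaussianChain_emChain (hW : IsBrownianMotion W P)
    (hσ : EllipticLipschitz σ lamLo lamHi L₀) (hb : Measurable b) (hδ : 0 < δ) (j : ℕ)
    (x : 𝔼 (Fin d)) :
    IsGaussianChain (covMatrix σ) b δ lamLo lamHi fun n => P.map (emChain b σ δ W j x n) where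
  elliptic := hσ.isElliptic
  measurable_qf := hσ.measurable_qf
  measurable_drift := hb
  step_pos := hδ
  prob n := Measure.isProbabilityMeasure_map (measurable_emChain hW hσ hb j x n).aemeasurable
  lintegral_succ n f hf := by
    have hX := measurable_emChain (δ := δ) hW hσ hb j x n
    have hI := hW.measurable_gridIncrement δ j n
    have hs := measurable_stepMap hσ hb δ
    have := Measure.isProbabilityMeasure_map (μ := P) hX.aemeasurable
    have := Measure.isProbabilityMeasure_map (μ := P) hI.aemeasurable
    have hprod := (indepFun_iff_map_prod_eq_prod_map_map hX.aemeasurable hI.aemeasurable).1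
      (indepFun_emChain hW hσ hb hδ j x n)
    have e1 : P.map (emChain b σ δ W j x (n + 1))
        = ((P.map (emChain b σ δ W j x n)).prod (P.map (gridIncrement W δ j n))).map
          (stepMap b σ δ) := by
      rw [← hprod, Measure.map_map hs (hX.prodMk hI)]
      rfl
    have hfs : Measurable fun p => f (stepMap b σ δ p) := hf.comp hs
    rw [e1, lintegral_map hf hs, lintegral_prod _ hfs.aemeasurable]
    refine lintegral_congr fun z => ?_
    have hz : Measurable fun u : 𝔼 (Fin m) => stepMap b σ δ (z, u) := hs.comp (by fun_prop)
    rw [← map_stepMap hW hσ hb hδ j n z, lintegral_map hf hz]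

end Chain

end

/-! ### Comparison with the stated constants. -/

section

/-- Deliberately crude: `√κ ≤ √κ ^ d`, `√d ≤ 2 ^ d` and `(4κ) ^ (d/2) = (2√κ) ^ d` multiply to `(4κ)
^ d`, and `4 ≤ 1 + 24 d`. -/
lemma sqrt_mul_rpow_le_pow {d : ℕ} (hd : 0 < d) {κ : ℝ} (hκ : 1 ≤ κ) :
    Real.sqrt κ * Real.sqrt d * (4 * κ) ^ ((d : ℝ) / 2) ≤ ((1 + 24 * d) * κ) ^ d := by
  have hd1 : (1 : ℝ) ≤ d := by exact_mod_cast hd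
  have h1 : (4 * κ) ^ ((d : ℝ) / 2) = (2 * Real.sqrt κ) ^ d := by
    have e : (2 * Real.sqrt κ) = (4 * κ) ^ ((1 : ℝ) / 2) := by
      rw [← Real.sqrt_eq_rpow, Real.sqrt_mul (by norm_num), show (4 : ℝ) = 2 ^ 2 by norm_num,
        Real.sqrt_sq (by norm_num)]
    rw [e, ← Real.rpow_natCast, ← Real.rpow_mul (by positivity)]
    congr 1; ring
  have h2 : Real.sqrt κ ≤ Real.sqrt κ ^ d := le_self_pow₀ (Real.one_le_sqrt.2 hκ) hd.ne'
  have h3 : Real.sqrt d ≤ 2 ^ d := by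
    refine (Real.sqrt_le_self_iff.2 (Or.inr hd1)).trans ?_
    exact_mod_cast Nat.lt_two_pow_self.le
  calc _ ≤ Real.sqrt κ ^ d * 2 ^ d * (2 * Real.sqrt κ) ^ d := by rw [h1]; gcongr
    _ = (4 * κ) ^ d := by
      rw [← mul_pow, ← mul_pow]
      congr 1
      nlinarith [Real.sq_sqrt (by linarith : 0 ≤ κ)]
    _ ≤ _ := by gcongr; linarith

/-- The first two summands of A_T dominate the drift and covariance parts up to a factor `√κ √d`,
with `κ = lamHi / lamLo`. That factor is absorbed in the large power on the right. -/
lemma kernelConst_mul_le (d m : ℕ) (hd : 0 < d) {B lamLo lamHi L₀ T : ℝ} (hB : 0 ≤ B)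
    (hlo : 0 < lamLo) (hle : lamLo ≤ lamHi) (hL : 0 ≤ L₀) (hT : 0 ≤ T) :
    kernelConst d B lamLo lamHi L₀ T * (4 * lamHi / lamLo) ^ ((d : ℝ) / 2)
      ≤ cHat d m B lamLo lamHi L₀ T * ((1 + 24 * d) * lamHi / lamLo) ^ d := by
  have hhi : 0 < lamHi := hlo.trans_le hle
  set κ := lamHi / lamLo with hκ
  have hκ1 : 1 ≤ κ := (one_le_div hlo).2 hle
  have hd1 : (1 : ℝ) ≤ d := by exact_mod_cast hd
  set e := Real.exp (B ^ 2 * T / lamHi) with he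
  have he1 : 1 ≤ e := Real.one_le_exp (by positivity)
  have hsd : 1 ≤ Real.sqrt d := Real.one_le_sqrt.2 hd1
  have hsκ : 1 ≤ Real.sqrt κ := Real.one_le_sqrt.2 hκ1
  have hslo : 0 < Real.sqrt lamLo := Real.sqrt_pos.2 hlo
  set A := 2 * (B / Real.sqrt lamLo + 2 * Real.sqrt d * L₀ * κ ^ 2
      + (d : ℝ) ^ ((d : ℝ) / 2 + 1) * (d.factorial : ℝ) * κ ^ d * L₀) * e with hA
  have hAc : A ≤ cHat d m B lamLo lamHi L₀ T := le_max_left _ _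
  have hA0 : 0 ≤ A := by positivity
  have hK : kernelConst d B lamLo lamHi L₀ T ≤ Real.sqrt κ * Real.sqrt d * A := by
    have e1 : Real.sqrt lamHi / lamLo = Real.sqrt κ / Real.sqrt lamLo := by
      rw [hκ, Real.sqrt_div hhi.le, div_div, Real.mul_self_sqrt hlo.le]
    have e2 : (d : ℝ) = Real.sqrt d * Real.sqrt d := (Real.mul_self_sqrt (by positivity)).symm
    have t1 : 2 * (Real.sqrt lamHi / lamLo * B * e)
        ≤ Real.sqrt κ * Real.sqrt d * (2 * (B / Real.sqrt lamLo) * e) := by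
      rw [e1]
      calc _ = Real.sqrt κ * 1 * (2 * (B / Real.sqrt lamLo) * e) := by ring
        _ ≤ _ := by gcongr
    have t2 : 4 * (d * L₀ * κ ^ 2)
        ≤ Real.sqrt κ * Real.sqrt d * (2 * (2 * Real.sqrt d * L₀ * κ ^ 2) * e) := by
      calc 4 * (d * L₀ * κ ^ 2)
          = 1 * Real.sqrt d * (2 * (2 * Real.sqrt d * L₀ * κ ^ 2) * 1) := by
            nth_rewrite 1 [e2]; ring
        _ ≤ _ := by gcongr
    have t3 : 0 ≤ Real.sqrt κ * Real.sqrt d *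
        (2 * ((d : ℝ) ^ ((d : ℝ) / 2 + 1) * (d.factorial : ℝ) * κ ^ d * L₀) * e) := by positivity
    rw [kernelConst, hA]
    linarith
  have e4 : 4 * lamHi / lamLo = 4 * κ := mul_div_assoc _ _ _
  have e5 : (1 + 24 * (d : ℝ)) * lamHi / lamLo = (1 + 24 * d) * κ := mul_div_assoc _ _ _
  rw [e4, e5]
  calc _ ≤ Real.sqrt κ * Real.sqrt d * A * (4 * κ) ^ ((d : ℝ) / 2) := by gcongr
    _ = A * (Real.sqrt κ * Real.sqrt d * (4 * κ) ^ ((d : ℝ) / 2)) := by ring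
    _ ≤ cHat d m B lamLo lamHi L₀ T * ((1 + 24 * d) * κ) ^ d :=
      mul_le_mul hAc (sqrt_mul_rpow_le_pow hd hκ1) (by positivity) (hA0.trans hAc)

lemma mittagLeffler_le_gaussConst (d m : ℕ) {B lamLo lamHi L₀ T y : ℝ} (hB : 0 ≤ B)
    (hhi : 0 < lamHi) (hT : 0 ≤ T) (hy : 0 ≤ y)
    (h : y ≤ Real.sqrt (Real.pi * T) * cHat d m B lamLo lamHi L₀ T
      * ((1 + 24 * d) * lamHi / lamLo) ^ d) :
    mittagLeffler y ≤ gaussConst d m B lamLo lamHi L₀ T := by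
  refine (mittagLeffler_mono hy h).trans ?_
  exact le_mul_of_one_le_left (mittagLeffler_nonneg (hy.trans h))
    (Real.one_le_exp (by positivity))

end

end EulerMaruyama

/-! ### Assembly: uniqueness of the continuous density and the final estimate. -/

open EulerMaruyama
theorem lemma5p2 {Ω : Type*} [MeasurableSpace Ω] (P : Measure Ω) [IsProbabilityMeasure P]
    {d m : ℕ} (hd : 0 < d)
    (W : ℝ≥0 → Ω → EuclideanSpace ℝ (Fin m)) (hW : IsBrownianMotion W P)
    (b : EuclideanSpace ℝ (Fin d) → EuclideanSpace ℝ (Fin d)) (hb_meas : Measurable b)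
    (hb : BddAbove (Set.range fun x => ‖b x‖))
    (σ : EuclideanSpace ℝ (Fin d) → Matrix (Fin d) (Fin m) ℝ) (lamLo lamHi L₀ : ℝ)
    (hσ : EllipticLipschitz σ lamLo lamHi L₀)
    (T δ : ℝ) (hδ0 : 0 < δ) (hδ1 : δ < 1) (j j' : ℕ) (hjj' : j < j') (hj' : j' ≤ ⌊T / δ⌋₊) :
    (∃ p, IsEMTransitionDensity P W b σ δ j j' p) ∧
    ∀ p, IsEMTransitionDensity P W b σ δ j j' p →
      ∀ x x' : EuclideanSpace ℝ (Fin d),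
        p x x' ≤ gaussConst d m (supNorm b) lamLo lamHi L₀ T
          * (Real.exp (-(‖x' - x‖ ^ 2 / (4 * (1 + 24 * d) * lamHi * (((j' : ℝ) - j) * δ))))
              / (2 * Real.pi * lamLo * (((j' : ℝ) - j) * δ)) ^ ((d : ℝ) / 2)) := by
  obtain ⟨n, rfl⟩ : ∃ n, j' = j + (n + 1) := ⟨j' - j - 1, by omega⟩
  have hsub : j + (n + 1) - j = n + 1 := by omega
  have hchain := fun x => isGaussianChain_emChain hW hσ hb_meas hδ0 j x
  have hcoef := hσ.coeffBounds hd hb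
  have hlo := hσ.lamLo_pos
  have hhi := hσ.lamHi_pos
  have hL := hσ.L₀_pos
  set q : EuclideanSpace ℝ (Fin d) → EuclideanSpace ℝ (Fin d) → ℝ := fun x =>
    stepDensity (covMatrix σ) b δ (P.map (emChain b σ δ W j x n)) with hq
  have hqdens : IsEMTransitionDensity P W b σ δ j (j + (n + 1)) q :=
    { nonneg := fun x y => (hchain x).stepDensity_nonneg n y
      continuous := fun x => (hchain x).continuous_stepDensity n
      law := fun x => by rw [hsub]; exact (hchain x).eq_withDensity n }
  refine ⟨⟨q, hqdens⟩, fun p hp x x' => ?_⟩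
  -- Two densities of the same finite law agree almost everywhere, and continuity upgrades this to
  -- equality everywhere.
  have hpq : p x = q x := by
    have hlaw := (hqdens.law x).symm.trans (hp.law x)
    have := (hchain x).prob (n + 1)
    rw [withDensity_eq_iff (hqdens.continuous x).measurable.ennreal_ofReal.aemeasurable
      (hp.continuous x).measurable.ennreal_ofReal.aemeasurable] at hlaw
    · refine ((Continuous.ae_eq_iff_eq volume (hp.continuous x) (hqdens.continuous x)).1 ?_)
      filter_upwards [hlaw] with y hy
      exact ((ENNReal.ofReal_eq_ofReal_iff (hqdens.nonneg x y) (hp.nonneg x y)).1 hy).symm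
    · have h1 : (volume.withDensity fun y => ENNReal.ofReal (q x y)) Set.univ = 1 := by
        rw [← hqdens.law x, hsub]
        exact measure_univ
      rw [withDensity_apply _ MeasurableSet.univ, setLIntegral_univ] at h1
      rw [h1]
      exact ENNReal.one_ne_top
  -- Since `j' ≠ 0`, the floor inequality needs no sign of `T / δ`; positivity of `T` is a
  -- consequence.
  have htime : ((j + (n + 1) : ℕ) : ℝ) * δ ≤ T := by
    rw [← le_div_iff₀ hδ0]
    exact (Nat.le_floor_iff' (by omega)).1 hj'
  have hnT : ((n + 1 : ℕ) : ℝ) * δ ≤ T := by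
    refine le_trans (mul_le_mul_of_nonneg_right ?_ hδ0.le) htime
    exact Nat.cast_le.2 (by omega)
  have hδT : δ ≤ T := by
    refine le_trans ?_ hnT
    push_cast
    nlinarith [mul_nonneg (Nat.cast_nonneg (α := ℝ) n) hδ0.le]
  have hT : 0 ≤ T := hδ0.le.trans hδT
  have hB : 0 ≤ supNorm b := (norm_nonneg _).trans (hcoef.drift x)
  have hdiff : ((j + (n + 1) : ℕ) : ℝ) - j = ((n + 1 : ℕ) : ℝ) := by push_cast; ring
  rw [hdiff, hpq]
  set t := ((n + 1 : ℕ) : ℝ) * δ with ht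
  have ht0 : 0 < t := by positivity
  set c := kernelConst d (supNorm b) lamLo lamHi L₀ T * (4 * lamHi / lamLo) ^ ((d : ℝ) / 2) with hc
  have hc0 : 0 ≤ c := by rw [hc, kernelConst]; positivity
  have hstart : P.map (emChain b σ δ W j x 0) = Measure.dirac x := by
    change P.map (fun _ => x) = _
    rw [Measure.map_const]
    simp
  have hbound := (hchain x).stepDensity_le hcoef hδT hstart rfl hc n x'
  have hconst : mittagLeffler (Real.sqrt Real.pi * c * Real.sqrt t)
      ≤ gaussConst d m (supNorm b) lamLo lamHi L₀ T := by
    refine mittagLeffler_le_gaussConst d m hB hhi hT (by positivity) ?_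
    have h1 := kernelConst_mul_le d m hd hB hlo hcoef.le hL.le hT
    rw [Real.sqrt_mul Real.pi_pos.le]
    calc Real.sqrt Real.pi * c * Real.sqrt t
        ≤ Real.sqrt Real.pi * (cHat d m (supNorm b) lamLo lamHi L₀ T
          * ((1 + 24 * d) * lamHi / lamLo) ^ d) * Real.sqrt T :=
          mul_le_mul (mul_le_mul_of_nonneg_left h1 (Real.sqrt_nonneg _)) (Real.sqrt_le_sqrt hnT)
            (Real.sqrt_nonneg _) (mul_nonneg (Real.sqrt_nonneg _) (hc0.trans h1))
      _ = _ := by ring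
  refine hbound.trans ?_
  rw [← ht, mul_comm ((4 * lamHi / lamLo) ^ ((d : ℝ) / 2)) (mittagLeffler _), mul_assoc,
    rpow_mul_isoDensity hlo hhi ht0, ← mul_assoc (2 * Real.pi) lamLo t]
  have hd1 : (1 : ℝ) ≤ d := by exact_mod_cast hd
  refine mul_le_mul hconst ?_ (by positivity)
    ((mittagLeffler_nonneg (by positivity)).trans hconst)
  -- Only `8 ≤ 4 * (1 + 24 * d)` is needed, which holds because `d ≥ 1`.
  gcongr
  linarith
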